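/- Let $n\ge 1$, let $\Omega\subset\mathbb R^n$ be a bounded open set with $C^\infty$ boundary, and let $Z=H^1(\Omega)$. Let $0<\alpha\le 1$, $b>0$, $p\in\mathbb N$, let $A$ generate a strongly continuous semigroup $\{\Phi(t)\}_{t\ge0}$ on $Z$, let $B:\mathbb R^p\to Z$ be linear and $z_0\in Z$. Consider the system $${}_0D_t^\alpha z(t)=Az(t)+Bu(t)\ \ (0\le t\le b),\qquad \lim_{t\to0^+}{}_0I_t^{1-\alpha}z(t)=z_0,$$ whose mild solution at time $b$ is defined to be $$z(b,u)=K_\alpha(b)z_0+\int_0^b(b-s)^{\alpha-1}K_\alpha(b-s)Bu(s)\,ds,\qquad K_\alpha(t)=\alpha\int_0^\infty\theta\phi_\alpha(\theta)\Phi(t^\alpha\theta)\,d\theta\ \ (0<\alpha<1),\quad K_1(t)=\Phi(t),$$ where $\phi_\alpha(\theta)=\frac1\alpha\theta^{-1-1/\alpha}\psi_\alpha(\theta^{-1/\alpha})$ and $\psi_\alpha(\theta)=\frac1\pi\sum_{k\ge1}(-1)^{k-1}\theta^{-\alpha k-1}\frac{\Gamma(k\alpha+1)}{k!}\sin(k\pi\alpha)$.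 A control is a function $u\in L^2(0,b;\mathbb R^p)$ for which $z(b,u)$ exists in $Z$, i.e. the integral over $(0,b)$ converges (as a Bochner integral). Let $\gamma:H^1(\Omega)\to L^2(\partial\Omega)$ be the trace operator, $H^{1/2}(\partial\Omega)$ its range with the norm $\|g\|=\inf\{\|w\|_{H^1(\Omega)}:\gamma w=g\}$. Let $\Gamma\subseteq\partial\Omega$ be a boundary subregion, possibly disconnected: a Borel set almost every point of which, for the surface measure, is interior to $\Gamma$ relative to $\partial\Omega$. Let $p_\Gamma$ be the restriction to $\Gamma$, $H^{1/2}(\Gamma)=p_\Gamma H^{1/2}(\partial\Omega)$ with the norm $\|z\|=\inf\{\|g\|:p_\Gamma g=z\}$, and let $p_\Gamma^*$ be the extension by zero from $\Gamma$ to $\partial\Omega$. Let $T:H^{1/2}(\partial\Omega)\to H^1(\Omega)$ be any continuous linear map with $\gamma Tg=g$ for all $g$, and put $$\Omega_2=\bigcup_{z_b}\operatorname{Supp}Tp_\Gamma^*z_b,\qquad D_r=\bigcup_{x\in\Gamma}B(x,r),\qquad \omega_r=D_r\cap\Omega_2\qquad(r>0),$$ where the first union is over all $z_b\in H^{1/2}(\Gamma)$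 with $p_\Gamma^*z_b\in H^{1/2}(\partial\Omega)$, and $\operatorname{Supp}$ is the (essential) support, a relatively closed subset of $\Omega$. For $\omega\subseteq\Omega$ let $H^1(\omega)$ be the space of restrictions $w|_\omega$ of functions $w\in H^1(\Omega)$, with the norm $\|y\|_{H^1(\omega)}=\inf\{\|w\|_{H^1(\Omega)}:w|_\omega=y\}$, and let $p_\omega$ be the restriction to $\omega$. The system is exactly (respectively, approximately) regionally controllable on $\omega$ if for every $y_b\in H^1(\omega)$ (and every $\varepsilon>0$) there is a control $u$ with $p_\omega z(b,u)=y_b$ (respectively, $\|p_\omega z(b,u)-y_b\|_{H^1(\omega)}\le\varepsilon$). It is exactly (respectively, approximately) regionally boundary controllable on $\Gamma$ if for every $z_b\in H^{1/2}(\Gamma)$ (and every $\varepsilon>0$) there is a control $u$ with $p_\Gamma\gamma z(b,u)=z_b$ (respectively, $\|p_\Gamma\gamma z(b,u)-z_b\|_{H^{1/2}(\Gamma)}\le\varepsilon$). Theorem 5.1. For every $r>0$: if the system is exactly (respectively, approximately) regionally controllable on $\omega_r$, then it is exactly (respectively, approximately) regionally boundary controllable on $\Gamma$. If $\omega_r$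 is open, both implications also hold with $H^1(\omega_r)$ taken to be the Sobolev space $W^{1,2}(\omega_r)$ with its usual norm $\big(\int_{\omega_r}|y|^2+|\nabla y|^2\big)^{1/2}$. -/

import Mathlib

open MeasureTheory Set Filter Topology
open scoped ContDiff ENNReal

namespace FracCtrl

noncomputable section

/-- Euclidean space `ℝⁿ`. -/
abbrev Euc (n : ℕ) : Type := EuclideanSpace ℝ (Fin n)

/-! ### The Sobolev space `H¹(U)` -/

/-- The ambient Hilbert space `L²(U) × L²(U; ℝⁿ)` with norm `(‖u‖² + ‖g‖²)^{1/2}`. -/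
abbrev L2Pair {n : ℕ} (U : Set (Euc n)) : Type :=
  WithLp 2 (Lp ℝ 2 ((volume : Measure (Euc n)).restrict U) ×
    Lp (Euc n) 2 ((volume : Measure (Euc n)).restrict U))

lemma memLp_of_test {n : ℕ} (U : Set (Euc n)) {F : Type*} [NormedAddCommGroup F] {f : Euc n → F}
    (hf : Continuous f) (hs : HasCompactSupport f) :
    MemLp f 2 ((volume : Measure (Euc n)).restrict U) :=
  (hf.memLp_of_hasCompactSupport hs).restrict U

lemma integral_mul_eq_inner {n : ℕ} (U : Set (Euc n)) {f : Euc n → ℝ}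
    (hf : MemLp f 2 ((volume : Measure (Euc n)).restrict U))
    (u : Lp ℝ 2 ((volume : Measure (Euc n)).restrict U)) :
    ∫ x in U, u x * f x = inner ℝ (hf.toLp f) u := by
  rw [L2.inner_def]
  apply integral_congr_ae
  filter_upwards [hf.coeFn_toLp] with x hx
  simp [hx]

lemma integral_inner_eq_inner {n : ℕ} (U : Set (Euc n)) {f : Euc n → ℝ} (v : Euc n)
    (hf : MemLp (fun x => f x • v) 2 ((volume : Measure (Euc n)).restrict U))
    (g : Lp (Euc n) 2 ((volume : Measure (Euc n)).restrict U)) :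
    ∫ x in U, inner ℝ (g x) v * f x = inner ℝ (hf.toLp _) g := by
  rw [L2.inner_def]
  apply integral_congr_ae
  filter_upwards [hf.coeFn_toLp] with x hx
  rw [hx, real_inner_smul_left, real_inner_comm, mul_comm]

/-- `g` is the weak gradient of `u` on `U`: for all `φ ∈ C_c^∞(U)` and all directions `v`,
`∫_U u ∂_v φ = - ∫_U ⟨g, v⟩ φ`. -/
def IsWeakGradient {n : ℕ} (U : Set (Euc n)) (u : Euc n → ℝ) (g : Euc n → Euc n) : Prop :=
  ∀ φ : Euc n → ℝ, ContDiff ℝ ∞ φ → HasCompactSupport φ → tsupport φ ⊆ U → ∀ v : Euc n,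
    ∫ x in U, u x * fderiv ℝ φ x v = - ∫ x in U, inner ℝ (g x) v * φ x

lemma test_deriv_memLp {n : ℕ} (U : Set (Euc n)) {φ : Euc n → ℝ} (h1 : ContDiff ℝ ∞ φ)
    (h2 : HasCompactSupport φ) (v : Euc n) :
    MemLp (fun x => fderiv ℝ φ x v) 2 ((volume : Measure (Euc n)).restrict U) :=
  memLp_of_test U ((h1.continuous_fderiv (by simp)).clm_apply continuous_const)
    (h2.fderiv_apply (𝕜 := ℝ) v)

lemma test_smul_memLp {n : ℕ} (U : Set (Euc n)) {φ : Euc n → ℝ} (h1 : ContDiff ℝ ∞ φ)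
    (h2 : HasCompactSupport φ) (v : Euc n) :
    MemLp (fun x => φ x • v) 2 ((volume : Measure (Euc n)).restrict U) :=
  memLp_of_test U (h1.continuous.smul continuous_const) h2.smul_right

lemma isWeakGradient_iff {n : ℕ} (U : Set (Euc n)) (q : L2Pair U) :
    IsWeakGradient U q.fst q.snd ↔
      ∀ (φ : Euc n → ℝ) (h1 : ContDiff ℝ ∞ φ) (h2 : HasCompactSupport φ), tsupport φ ⊆ U →
        ∀ v : Euc n, inner ℝ ((test_deriv_memLp U h1 h2 v).toLp _) q.fst
          = - inner ℝ ((test_smul_memLp U h1 h2 v).toLp _) q.snd := by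
  constructor
  · intro h φ h1 h2 h3 v
    rw [← integral_mul_eq_inner, ← integral_inner_eq_inner]
    exact h φ h1 h2 h3 v
  · intro h φ h1 h2 h3 v
    rw [integral_mul_eq_inner U (test_deriv_memLp U h1 h2 v),
      integral_inner_eq_inner U v (test_smul_memLp U h1 h2 v)]
    exact h φ h1 h2 h3 v

/-- `H¹(U)` as the subspace of all pairs `(u, g)` in `L²(U) × L²(U; ℝⁿ)` such that `g` is the weak
gradient of `u`. -/
def sobolevSubmodule {n : ℕ} (U : Set (Euc n)) : Submodule ℝ (L2Pair U) where
  carrier := {q | IsWeakGradient U q.fst q.snd}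
  add_mem' := by
    intro a b ha hb
    simp only [mem_ofPred_eq, isWeakGradient_iff] at ha hb ⊢
    intro φ h1 h2 h3 v
    rw [WithLp.add_fst, WithLp.add_snd, inner_add_right, inner_add_right, ha φ h1 h2 h3 v,
      hb φ h1 h2 h3 v]
    ring
  zero_mem' := by
    simp only [mem_ofPred_eq, isWeakGradient_iff]
    intro φ h1 h2 h3 v
    simp
  smul_mem' := by
    intro c a ha
    simp only [mem_ofPred_eq, isWeakGradient_iff] at ha ⊢
    intro φ h1 h2 h3 v
    rw [WithLp.smul_fst, WithLp.smul_snd, inner_smul_right, inner_smul_right, ha φ h1 h2 h3 v]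
    ring

lemma isClosed_sobolevSubmodule {n : ℕ} (U : Set (Euc n)) :
    IsClosed (sobolevSubmodule U : Set (L2Pair U)) := by
  have : (sobolevSubmodule U : Set (L2Pair U)) =
      ⋂ (φ : Euc n → ℝ) (h1 : ContDiff ℝ ∞ φ) (h2 : HasCompactSupport φ) (_ : tsupport φ ⊆ U)
        (v : Euc n), {q : L2Pair U | inner ℝ ((test_deriv_memLp U h1 h2 v).toLp _) q.fst
          = - inner ℝ ((test_smul_memLp U h1 h2 v).toLp _) q.snd} := by
    ext q
    simp only [mem_iInter, mem_ofPred_eq]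
    exact isWeakGradient_iff U q
  rw [this]
  refine isClosed_iInter fun φ => isClosed_iInter fun h1 => isClosed_iInter fun h2 =>
    isClosed_iInter fun _ => isClosed_iInter fun v => isClosed_eq ?_ ?_
  · exact continuous_const.inner (WithLp.prod_continuous_ofLp 2 _ _).fst
  · exact (continuous_const.inner (WithLp.prod_continuous_ofLp 2 _ _).snd).neg

/-- The Sobolev space `H¹(U) = W^{1,2}(U)`, normed by
`‖u‖² = ∫_U |u|² + ∫_U |∇u|²`. -/
abbrev H1 {n : ℕ} (U : Set (Euc n)) : Type := sobolevSubmodule U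

instance {n : ℕ} (U : Set (Euc n)) : CompleteSpace (H1 U) :=
  (isClosed_sobolevSubmodule U).completeSpace_coe

/-- The underlying function (class) of an element of `H¹(U)`. -/
def H1.fn {n : ℕ} {U : Set (Euc n)} (w : H1 U) : Lp ℝ 2 ((volume : Measure (Euc n)).restrict U) :=
  w.1.fst

/-! ### Smooth domains, the boundary measure and traces -/

/-- Smooth boundary: near each boundary point, in suitable orthogonal coordinates, `Ω` is the
region lying strictly above the graph of a smooth function of the other `n - 1` coordinates.
Here `ν` is the unit vector of the distinguished coordinate, and that `γ` depends on the other
coordinates only is expressed by its invariance under translations along `ν`. -/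
def HasSmoothBoundary {n : ℕ} (Ω : Set (Euc n)) : Prop :=
  ∀ x ∈ frontier Ω, ∃ (ν : Euc n) (γ : Euc n → ℝ) (ρ : ℝ), ‖ν‖ = 1 ∧ ContDiff ℝ ∞ γ ∧
    (∀ (y : Euc n) (t : ℝ), γ (y + t • ν) = γ y) ∧ 0 < ρ ∧
    Ω ∩ Metric.ball x ρ = {y | y ∈ Metric.ball x ρ ∧ γ y < inner ℝ y ν}

/-- The `(n-1)`-dimensional Hausdorff measure on `S ⊆ ℝⁿ` (on a smooth hypersurface: the surface
measure, up to a constant factor depending on `n` only). -/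
def surf {n : ℕ} (S : Set (Euc n)) : Measure (Euc n) :=
  (Measure.hausdorffMeasure ((n : ℝ) - 1)).restrict S

/-- Pairs `(w, h)` in `H¹(Ω) × L²(∂Ω)` such that some smooth `φ` on `ℝⁿ` has `w = φ` on `Ω` and
`h = φ` on `∂Ω`. -/
def smoothTraceGraph {n : ℕ} (Ω : Set (Euc n)) :
    Submodule ℝ (H1 Ω × Lp ℝ 2 (surf (frontier Ω))) where
  carrier := {q | ∃ φ : Euc n → ℝ, ContDiff ℝ ∞ φ ∧ q.1.fn =ᵐ[volume.restrict Ω] φ ∧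
    q.2 =ᵐ[surf (frontier Ω)] φ}
  add_mem' := by
    rintro a b ⟨φ, h1, h2, h3⟩ ⟨ψ, k1, k2, k3⟩
    refine ⟨φ + ψ, h1.add k1, ?_, ?_⟩
    · exact (Lp.coeFn_add a.1.fn b.1.fn).trans (h2.add k2)
    · exact (Lp.coeFn_add a.2 b.2).trans (h3.add k3)
  zero_mem' := ⟨0, contDiff_const, Lp.coeFn_zero _ _ _, Lp.coeFn_zero _ _ _⟩
  smul_mem' := by
    rintro c a ⟨φ, h1, h2, h3⟩
    refine ⟨c • φ, contDiff_const.smul h1, ?_, ?_⟩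
    · exact (Lp.coeFn_smul c a.1.fn).trans (h2.const_smul c)
    · exact (Lp.coeFn_smul c a.2).trans (h3.const_smul c)

/-- The graph of the trace operator `γ : H¹(Ω) → L²(∂Ω)`, the continuous extension of
`φ ↦ φ|_∂Ω` from smooth functions to `H¹(Ω)`. -/
def traceGraph {n : ℕ} (Ω : Set (Euc n)) : Submodule ℝ (H1 Ω × Lp ℝ 2 (surf (frontier Ω))) :=
  (smoothTraceGraph Ω).topologicalClosure

/-- `γ w = g`. -/
def HasTrace {n : ℕ} {Ω : Set (Euc n)} (w : H1 Ω) (g : Lp ℝ 2 (surf (frontier Ω))) : Prop :=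
  (w, g) ∈ traceGraph Ω

/-- `H^{1/2}(∂Ω)`, the range of the trace operator on `H¹(Ω)`. -/
def Hhalf {n : ℕ} (Ω : Set (Euc n)) : Submodule ℝ (Lp ℝ 2 (surf (frontier Ω))) :=
  (traceGraph Ω).map (LinearMap.snd ℝ _ _)

/-- The norm of `H^{1/2}(∂Ω)`: `‖g‖ = inf {‖w‖_{H¹(Ω)} : γ w = g}`. -/
def HhalfNorm {n : ℕ} {Ω : Set (Euc n)} (g : Hhalf Ω) : ℝ :=
  sInf {c | ∃ w : H1 Ω, HasTrace w g ∧ c = ‖w‖}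

/-- `p_Γ g = z`: the function `z` on `Γ` is the restriction to `Γ` of `g` on `∂Ω`. -/
def IsRestriction {n : ℕ} {Ω : Set (Euc n)} (Γ : Set (Euc n)) (g : Lp ℝ 2 (surf (frontier Ω)))
    (z : Lp ℝ 2 (surf Γ)) : Prop :=
  z =ᵐ[surf Γ] g

/-- `p_Γ (γ w) = z`. -/
def HasTraceOn {n : ℕ} {Ω : Set (Euc n)} (Γ : Set (Euc n)) (w : H1 Ω)
    (z : Lp ℝ 2 (surf Γ)) : Prop :=
  ∃ g : Lp ℝ 2 (surf (frontier Ω)), HasTrace w g ∧ IsRestriction Γ g z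

/-- `z ∈ H^{1/2}(Γ)`: `z` is the restriction to `Γ` of some element of `H^{1/2}(∂Ω)`. -/
def MemHhalfOn {n : ℕ} (Ω Γ : Set (Euc n)) (z : Lp ℝ 2 (surf Γ)) : Prop :=
  ∃ g : Hhalf Ω, IsRestriction Γ (g : Lp ℝ 2 (surf (frontier Ω))) z

/-- The norm of `H^{1/2}(Γ)`: the infimum of `‖g‖_{H^{1/2}(∂Ω)}` over all `g` with `p_Γ g = z`. -/
def HhalfNormOn {n : ℕ} (Ω Γ : Set (Euc n)) (z : Lp ℝ 2 (surf Γ)) : ℝ :=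
  sInf {c | ∃ g : Hhalf Ω, IsRestriction Γ (g : Lp ℝ 2 (surf (frontier Ω))) z ∧ c = HhalfNorm g}

/-- `p_Γ^* z = g`: `g` is the extension of `z` by zero from `Γ` to `∂Ω`. -/
def IsZeroExtension {n : ℕ} {Ω : Set (Euc n)} (Γ : Set (Euc n)) (z : Lp ℝ 2 (surf Γ))
    (g : Lp ℝ 2 (surf (frontier Ω))) : Prop :=
  g =ᵐ[surf Γ] z ∧ g =ᵐ[surf (frontier Ω \ Γ)] 0

/-- A subregion `Γ` of `∂Ω`: a Borel subset of `∂Ω`, almost every point of which (for the surface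
measure) is interior to `Γ` relative to `∂Ω`. It need not be connected. -/
def IsBoundaryRegion {n : ℕ} (Ω Γ : Set (Euc n)) : Prop :=
  Γ ⊆ frontier Ω ∧ MeasurableSet Γ ∧ surf Γ {x | Γ ∉ 𝓝[frontier Ω] x} = 0

/-- `T : H^{1/2}(∂Ω) → H¹(Ω)` is a continuous (linear) lifting: `γ T g = g` for all `g`. -/
def IsTraceLifting {n : ℕ} {Ω : Set (Euc n)} (T : Hhalf Ω →ₗ[ℝ] H1 Ω) : Prop :=
  (∃ C : ℝ, ∀ g : Hhalf Ω, ‖T g‖ ≤ C * HhalfNorm g) ∧ ∀ g : Hhalf Ω, HasTrace (T g) g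

/-- The support of `w ∈ H¹(Ω)`: the points of `Ω` in no neighbourhood of which `w` vanishes
almost everywhere. -/
def suppH1 {n : ℕ} {Ω : Set (Euc n)} (w : H1 Ω) : Set (Euc n) :=
  {x | x ∈ Ω ∧ ∀ U ∈ 𝓝 x, ¬ w.fn =ᵐ[volume.restrict (Ω ∩ U)] 0}

/-- `Ω₂ = ⋃ Supp (T p_Γ^* z)`, the union over the `z ∈ H^{1/2}(Γ)` whose extension by zero lies
in the domain `H^{1/2}(∂Ω)` of `T`. -/
def liftedSupport {n : ℕ} {Ω : Set (Euc n)} (T : Hhalf Ω →ₗ[ℝ] H1 Ω) (Γ : Set (Euc n)) :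
    Set (Euc n) :=
  {x | ∃ (z : Lp ℝ 2 (surf Γ)) (g : Hhalf Ω), MemHhalfOn Ω Γ z ∧
    IsZeroExtension Γ z (g : Lp ℝ 2 (surf (frontier Ω))) ∧ x ∈ suppH1 (T g)}

/-- `ω_r = D_r ∩ Ω₂` with `D_r = ⋃_{x ∈ Γ} B(x, r)`. -/
def omegaR {n : ℕ} {Ω : Set (Euc n)} (T : Hhalf Ω →ₗ[ℝ] H1 Ω) (Γ : Set (Euc n)) (r : ℝ) :
    Set (Euc n) :=
  (⋃ x ∈ Γ, Metric.ball x r) ∩ liftedSupport T Γ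

/-! ### The time fractional system -/

/-- The probability density
`ψ_α(θ) = (1/π) ∑_{k ≥ 1} (-1)^{k-1} θ^{-αk-1} Γ(kα+1)/k! sin(kπα)`, `θ > 0` (here `k = j + 1`). -/
def psi (α θ : ℝ) : ℝ :=
  (1 / Real.pi) * ∑' j : ℕ, (-1 : ℝ) ^ j * θ ^ (-α * ((j : ℝ) + 1) - 1) *
    (Real.Gamma (((j : ℝ) + 1) * α + 1) / (Nat.factorial (j + 1) : ℝ)) *
    Real.sin (((j : ℝ) + 1) * Real.pi * α)

/-- `φ_α(θ) = (1/α) θ^{-1-1/α} ψ_α(θ^{-1/α})`. -/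
def phi (α θ : ℝ) : ℝ := (1 / α) * θ ^ (-1 - 1 / α) * psi α (θ ^ (-(1 / α)))

/-- `K_α(t) z = α ∫_0^∞ θ φ_α(θ) Φ(t^α θ) z dθ`. For `α = 1` the density `φ_α` degenerates to the
unit mass at `θ = 1`, and `K_1(t) = Φ(t)`. -/
def fracOp {Z : Type*} [NormedAddCommGroup Z] [NormedSpace ℝ Z] (Φ : ℝ → Z →L[ℝ] Z)
    (α t : ℝ) (z : Z) : Z :=
  if α = 1 then Φ t z else α • ∫ θ in Ioi (0 : ℝ), (θ * phi α θ) • Φ (t ^ α * θ) z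

/-- `{Φ(t)}_{t ≥ 0}` is a strongly continuous semigroup (values at `t < 0` are irrelevant). -/
structure IsC0Semigroup {Z : Type*} [NormedAddCommGroup Z] [NormedSpace ℝ Z]
    (Φ : ℝ → Z →L[ℝ] Z) : Prop where
  map_zero : Φ 0 = ContinuousLinearMap.id ℝ Z
  map_add : ∀ s t : ℝ, 0 ≤ s → 0 ≤ t → Φ (s + t) = (Φ s).comp (Φ t)
  continuousOn : ∀ z : Z, ContinuousOn (fun t => Φ t z) (Ici 0)

/-- The (in general unbounded) operator `A` is the infinitesimal generator of `{Φ(t)}_{t ≥ 0}`: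
`x ∈ D(A)` with `A x = y` iff `(Φ(h) x - x) / h → y` as `h → 0⁺`. -/
def Generates {Z : Type*} [NormedAddCommGroup Z] [NormedSpace ℝ Z] (A : Z →ₗ.[ℝ] Z)
    (Φ : ℝ → Z →L[ℝ] Z) : Prop :=
  ∀ x y : Z, (x, y) ∈ A.graph ↔
    Tendsto (fun h : ℝ => h⁻¹ • (Φ h x - x)) (𝓝[>] 0) (𝓝 y)

/-- The data of the system `D_t^α z = A z + B u` on `[0, b]`, `I_t^{1-α} z (0⁺) = z₀`, in the state
space `Z = H¹(Ω)`, with `p` scalar controls. -/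
structure FracSystem {n : ℕ} (Ω : Set (Euc n)) (p : ℕ) where
  α : ℝ
  α_pos : 0 < α
  α_le_one : α ≤ 1
  b : ℝ
  b_pos : 0 < b
  A : H1 Ω →ₗ.[ℝ] H1 Ω
  Φ : ℝ → H1 Ω →L[ℝ] H1 Ω
  isC0Semigroup : IsC0Semigroup Φ
  generates : Generates A Φ
  B : Euc p →L[ℝ] H1 Ω
  z₀ : H1 Ω

/-- `u ∈ L²(0, b; ℝᵖ)` is a control for which the mild solution is defined at time `b`, with
`z(b, u) = K_α(b) z₀ + ∫_0^b (b-s)^{α-1} K_α(b-s) B u(s) ds = z`. -/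
def FracSystem.Steers {n : ℕ} {Ω : Set (Euc n)} {p : ℕ} (S : FracSystem Ω p)
    (u : ℝ → Euc p) (z : H1 Ω) : Prop :=
  MemLp u 2 (volume.restrict (Ioc 0 S.b)) ∧
  IntervalIntegrable (fun s => (S.b - s) ^ (S.α - 1) • fracOp S.Φ S.α (S.b - s) (S.B (u s)))
    volume 0 S.b ∧
  z = fracOp S.Φ S.α S.b S.z₀ +
    ∫ s in (0 : ℝ)..S.b, (S.b - s) ^ (S.α - 1) • fracOp S.Φ S.α (S.b - s) (S.B (u s))

/-! ### Regional controllability inside `Ω` -/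

/-- The functions of `H¹(Ω)` that vanish almost everywhere on `O ⊆ Ω`. -/
def vanishingOn {n : ℕ} (Ω O : Set (Euc n)) : Submodule ℝ (H1 Ω) where
  carrier := {w | w.fn =ᵐ[volume.restrict (Ω ∩ O)] 0}
  add_mem' := by
    intro a b ha hb
    have h : (a + b).fn =ᵐ[volume.restrict (Ω ∩ O)] ⇑a.fn + ⇑b.fn :=
      ae_restrict_of_ae_restrict_of_subset inter_subset_left (Lp.coeFn_add a.fn b.fn)
    simp only [mem_ofPred_eq] at ha hb ⊢
    filter_upwards [h, ha, hb] with x h1 h2 h3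
    simp [h1, h2, h3]
  zero_mem' :=
    ae_restrict_of_ae_restrict_of_subset inter_subset_left (Lp.coeFn_zero ℝ 2 _)
  smul_mem' := by
    intro c a ha
    have h : (c • a).fn =ᵐ[volume.restrict (Ω ∩ O)] c • ⇑a.fn :=
      ae_restrict_of_ae_restrict_of_subset inter_subset_left (Lp.coeFn_smul c a.fn)
    simp only [mem_ofPred_eq] at ha ⊢
    filter_upwards [h, ha] with x h1 h2
    simp [h1, h2]

/-- For an arbitrary `O ⊆ Ω`, the space `{w|_O : w ∈ H¹(Ω)}` of restrictions, with the norm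
`‖y‖ = inf {‖w‖_{H¹(Ω)} : w|_O = y}`, as the quotient of `H¹(Ω)` by the functions vanishing
on `O`. -/
abbrev H1Restr {n : ℕ} (Ω O : Set (Euc n)) : Type := H1 Ω ⧸ vanishingOn Ω O

/-- The restriction map `p_O` from `H¹(Ω)` to the space of restrictions to `O`. -/
def restr {n : ℕ} {Ω : Set (Euc n)} (O : Set (Euc n)) (w : H1 Ω) : H1Restr Ω O :=
  (vanishingOn Ω O).mkQ w

/-- Exact regional controllability on `O`, targets in the space of restrictions. -/
def FracSystem.ExactlyControllableOn {n : ℕ} {Ω : Set (Euc n)} {p : ℕ} (S : FracSystem Ω p)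
    (O : Set (Euc n)) : Prop :=
  ∀ y : H1Restr Ω O, ∃ u z, S.Steers u z ∧ restr O z = y

/-- Approximate regional controllability on `O`, targets in the space of restrictions. -/
def FracSystem.ApproxControllableOn {n : ℕ} {Ω : Set (Euc n)} {p : ℕ} (S : FracSystem Ω p)
    (O : Set (Euc n)) : Prop :=
  ∀ y : H1Restr Ω O, ∀ ε > 0, ∃ u z, S.Steers u z ∧ ‖restr O z - y‖ ≤ ε

/-- For an open `O ⊆ Ω`: the element `y` of the Sobolev space `H¹(O)` is `p_O w = w|_O`. -/
def IsSobolevRestr {n : ℕ} {Ω O : Set (Euc n)} (w : H1 Ω) (y : H1 O) : Prop :=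
  y.fn =ᵐ[volume.restrict O] w.fn

/-- Exact regional controllability on an open `O`, targets in the Sobolev space `H¹(O)`. -/
def FracSystem.ExactlyControllableOnOpen {n : ℕ} {Ω : Set (Euc n)} {p : ℕ} (S : FracSystem Ω p)
    (O : Set (Euc n)) : Prop :=
  ∀ y : H1 O, ∃ u z, S.Steers u z ∧ IsSobolevRestr z y

/-- Approximate regional controllability on an open `O`, targets in the Sobolev space `H¹(O)`. -/
def FracSystem.ApproxControllableOnOpen {n : ℕ} {Ω : Set (Euc n)} {p : ℕ} (S : FracSystem Ω p)
    (O : Set (Euc n)) : Prop :=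
  ∀ y : H1 O, ∀ ε > 0, ∃ u z, S.Steers u z ∧
    ∃ y' : H1 O, IsSobolevRestr z y' ∧ ‖y' - y‖ ≤ ε

/-! ### Regional boundary controllability -/

/-- Exact regional boundary controllability on `Γ`. -/
def FracSystem.ExactlyBoundaryControllableOn {n : ℕ} {Ω : Set (Euc n)} {p : ℕ}
    (S : FracSystem Ω p) (Γ : Set (Euc n)) : Prop :=
  ∀ zb : Lp ℝ 2 (surf Γ), MemHhalfOn Ω Γ zb → ∃ u z, S.Steers u z ∧ HasTraceOn Γ z zb

/-- Approximate regional boundary controllability on `Γ`. -/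
def FracSystem.ApproxBoundaryControllableOn {n : ℕ} {Ω : Set (Euc n)} {p : ℕ}
    (S : FracSystem Ω p) (Γ : Set (Euc n)) : Prop :=
  ∀ zb : Lp ℝ 2 (surf Γ), MemHhalfOn Ω Γ zb → ∀ ε > 0, ∃ u z, S.Steers u z ∧
    ∃ y : Lp ℝ 2 (surf Γ), HasTraceOn Γ z y ∧ HhalfNormOn Ω Γ (y - zb) ≤ ε

end

end FracCtrl

namespace FracCtrl


/-! Given `zb` on `Γ`, choose any `w` in `H¹(Ω)` whose trace restricts to `zb` and steer the system
to a state `z` that agrees with `w` on `ω_r`. Zero extension of `zb` may leave `H^{1/2}(∂Ω)`, so `w`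
need not be a lifting of it. What has to be shown is that `v = z - w`, which vanishes on `Ω₂` near
`Γ`, has zero trace on `Γ`, although `Ω₂` could a priori be thin there (`trace_eq_zero_on`).

Near a point `x` interior to `Γ`, take a bump `b` whose boundary values vanish off `Γ`, and let `q`
be the lifting by `T` of `b|_∂Ω`. By the definition of `Ω₂`, the support of `q` lies in `Ω₂`, so `v
* q = 0` near `x`. Functions of `H¹` whose product vanishes near `x` have traces whose product
vanishes near `x` (`trace_mul_trace_eq_zero`). The trace of `q` is `1` near `x`, so the trace of `v`
is `0` there, and almost every point of `Γ` is such an `x`.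

The product statement follows from the `W^{1,1}` trace inequality `∫_∂Ω |χ γ(v) γ(w)| ≤ C ∫_Ω |∂_ν(χ
v w)|`. It is proved for smooth functions in a boundary chart and extended by closing the graph.
Together with the density of smooth functions (`closure_smoothH1`) it also makes the trace a
bounded, everywhere defined operator.

For approximate controllability an error `e` with `‖e‖ ≤ ε` is found such that `z - w - e` vanishes
on `Ω₂` near `Γ`; the boundary error is then the trace of `e`. With the quotient norm, `e` is a
near-minimal representative. With the norm of `W^{1,2}(ω_r)`, `e` is a bounded extension of the
error on `ω_r` (`exists_extension_omegaR`): a cutoff near `Γ` followed by extension by zero. No jump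
arises because `Ω₂` is relatively closed in `Ω`, which is a Baire category argument
(`isOpen_diff_liftedSupport`). -/

/-! ### Elements of `H¹(U)` from functions -/

/-- The weak gradient of an element of `H¹(U)`. -/
noncomputable def H1.grad {n : ℕ} {U : Set (Euc n)} (w : H1 U) :
    Lp (Euc n) 2 ((volume : Measure (Euc n)).restrict U) :=
  w.1.snd

lemma H1.isWeakGradient {n : ℕ} {U : Set (Euc n)} (w : H1 U) : IsWeakGradient U w.fn w.grad :=
  w.2

lemma H1.norm_sq {n : ℕ} {U : Set (Euc n)} (w : H1 U) :
    ‖w‖ ^ 2 = ‖w.fn‖ ^ 2 + ‖w.grad‖ ^ 2 :=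
  WithLp.prod_norm_sq_eq_of_L2 w.1

lemma H1.norm_fn_le {n : ℕ} {U : Set (Euc n)} (w : H1 U) : ‖w.fn‖ ≤ ‖w‖ :=
  WithLp.norm_fst_le _ w.1

lemma H1.norm_grad_le {n : ℕ} {U : Set (Euc n)} (w : H1 U) : ‖w.grad‖ ≤ ‖w‖ :=
  WithLp.norm_snd_le _ w.1

lemma H1.norm_le_add {n : ℕ} {U : Set (Euc n)} (w : H1 U) : ‖w‖ ≤ ‖w.fn‖ + ‖w.grad‖ := by
  have := w.norm_sq
  nlinarith [norm_nonneg w, norm_nonneg w.fn, norm_nonneg w.grad]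

lemma H1.ext' {n : ℕ} {U : Set (Euc n)} {v w : H1 U} (h1 : v.fn =ᵐ[volume.restrict U] w.fn)
    (h2 : v.grad =ᵐ[volume.restrict U] w.grad) : v = w := by
  apply Subtype.ext
  apply (WithLp.equiv 2 _).injective
  exact Prod.ext (Lp.ext h1) (Lp.ext h2)

lemma H1.coeFn_fn_add {n : ℕ} {U : Set (Euc n)} (v w : H1 U) :
    (v + w).fn =ᵐ[volume.restrict U] ⇑v.fn + ⇑w.fn := Lp.coeFn_add v.fn w.fn

lemma H1.coeFn_fn_sub {n : ℕ} {U : Set (Euc n)} (v w : H1 U) :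
    (v - w).fn =ᵐ[volume.restrict U] ⇑v.fn - ⇑w.fn := Lp.coeFn_sub v.fn w.fn

lemma H1.coeFn_fn_smul {n : ℕ} {U : Set (Euc n)} (c : ℝ) (w : H1 U) :
    (c • w).fn =ᵐ[volume.restrict U] c • ⇑w.fn := Lp.coeFn_smul c w.fn

lemma H1.coeFn_grad_add {n : ℕ} {U : Set (Euc n)} (v w : H1 U) :
    (v + w).grad =ᵐ[volume.restrict U] ⇑v.grad + ⇑w.grad := Lp.coeFn_add v.grad w.grad

lemma H1.coeFn_grad_smul {n : ℕ} {U : Set (Euc n)} (c : ℝ) (w : H1 U) :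
    (c • w).grad =ᵐ[volume.restrict U] c • ⇑w.grad := Lp.coeFn_smul c w.grad

lemma IsWeakGradient.congr {n : ℕ} {U : Set (Euc n)} {u u' : Euc n → ℝ} {g g' : Euc n → Euc n}
    (h : IsWeakGradient U u g) (hu : u =ᵐ[volume.restrict U] u')
    (hg : g =ᵐ[volume.restrict U] g') : IsWeakGradient U u' g' := by
  intro φ h1 h2 h3 v
  have e1 : ∫ x in U, u' x * fderiv ℝ φ x v = ∫ x in U, u x * fderiv ℝ φ x v := by
    apply integral_congr_ae
    filter_upwards [hu] with x hx
    rw [hx]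
  have e2 : ∫ x in U, inner ℝ (g' x) v * φ x = ∫ x in U, inner ℝ (g x) v * φ x := by
    apply integral_congr_ae
    filter_upwards [hg] with x hx
    rw [hx]
  rw [e1, e2]
  exact h φ h1 h2 h3 v

lemma exists_H1_of_isWeakGradient {n : ℕ} {U : Set (Euc n)} {u : Euc n → ℝ} {g : Euc n → Euc n}
    (hu : MemLp u 2 (volume.restrict U)) (hg : MemLp g 2 (volume.restrict U))
    (h : IsWeakGradient U u g) :
    ∃ w : H1 U, w.fn =ᵐ[volume.restrict U] u ∧ w.grad =ᵐ[volume.restrict U] g :=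
  ⟨⟨WithLp.toLp 2 (hu.toLp u, hg.toLp g),
    h.congr hu.coeFn_toLp.symm hg.coeFn_toLp.symm⟩, hu.coeFn_toLp, hg.coeFn_toLp⟩

lemma contDiff_gradient {n : ℕ} {φ : Euc n → ℝ} (h : ContDiff ℝ ∞ φ) :
    ContDiff ℝ ∞ (gradient φ) := by
  have : gradient φ = fun x => (InnerProductSpace.toDual ℝ (Euc n)).symm (fderiv ℝ φ x) := rfl
  rw [this]
  exact (InnerProductSpace.toDual ℝ (Euc n)).symm.contDiff.comp
    (h.fderiv_right (m := ∞) (by simp))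

lemma inner_gradient {n : ℕ} (φ : Euc n → ℝ) (x v : Euc n) :
    inner ℝ (gradient φ x) v = fderiv ℝ φ x v := by
  simp [gradient]

lemma setIntegral_eq_of_tsupport {n : ℕ} {U : Set (Euc n)} {f : Euc n → ℝ}
    (h : tsupport f ⊆ U) : ∫ x in U, f x = ∫ x, f x :=
  setIntegral_eq_integral_of_forall_compl_eq_zero fun _ hx =>
    image_eq_zero_of_notMem_tsupport fun h' => hx (h h')

/-- Test functions are supported in `U`, so both integrals extend to the whole space, where
integration by parts has no boundary term. Hence `U` may be any set. -/
lemma isWeakGradient_of_contDiff {n : ℕ} (U : Set (Euc n)) {f : Euc n → ℝ}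
    (hf : ContDiff ℝ ∞ f) : IsWeakGradient U f (gradient f) := by
  intro φ h1 h2 h3 v
  simp_rw [inner_gradient]
  have hφ' : HasCompactSupport fun x => fderiv ℝ φ x v := h2.fderiv_apply (𝕜 := ℝ) v
  have c1 : Continuous fun x => fderiv ℝ φ x v :=
    (h1.continuous_fderiv (by simp)).clm_apply continuous_const
  have c2 : Continuous fun x => fderiv ℝ f x v :=
    (hf.continuous_fderiv (by simp)).clm_apply continuous_const
  have t1 : tsupport (fun x => f x * fderiv ℝ φ x v) ⊆ U :=
    (tsupport_mul_subset_right).trans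
      ((tsupport_fderiv_apply_subset ℝ v).trans h3)
  have t2 : tsupport (fun x => fderiv ℝ f x v * φ x) ⊆ U :=
    (tsupport_mul_subset_right).trans h3
  rw [setIntegral_eq_of_tsupport t1, setIntegral_eq_of_tsupport t2]
  apply integral_mul_fderiv_eq_neg_fderiv_mul_of_integrable
  · exact (c2.mul h1.continuous).integrable_of_hasCompactSupport h2.mul_left
  · exact (hf.continuous.mul c1).integrable_of_hasCompactSupport hφ'.mul_left
  · exact (hf.continuous.mul h1.continuous).integrable_of_hasCompactSupport h2.mul_left
  · exact fun x _ => hf.differentiable (by simp) x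
  · exact fun x _ => h1.differentiable (by simp) x

lemma memLp_restrict_of_continuous {n : ℕ} {U : Set (Euc n)} (hU : Bornology.IsBounded U)
    {F : Type*} [NormedAddCommGroup F] {f : Euc n → F} (hf : Continuous f) :
    MemLp f 2 ((volume : Measure (Euc n)).restrict U) := by
  have hK : IsCompact (closure U) := hU.isCompact_closure
  obtain ⟨C, hC⟩ := hK.exists_bound_of_continuousOn hf.continuousOn
  have : IsFiniteMeasure ((volume : Measure (Euc n)).restrict (closure U)) :=
    isFiniteMeasure_restrict.2 hK.measure_lt_top.ne
  have : MemLp f 2 ((volume : Measure (Euc n)).restrict (closure U)) :=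
    MemLp.of_bound hf.aestronglyMeasurable C
      ((ae_restrict_mem isClosed_closure.measurableSet).mono hC)
  exact this.mono_measure (Measure.restrict_mono subset_closure le_rfl)

lemma exists_H1_of_contDiff {n : ℕ} {U : Set (Euc n)} (hU : Bornology.IsBounded U)
    {φ : Euc n → ℝ} (hφ : ContDiff ℝ ∞ φ) :
    ∃ w : H1 U, w.fn =ᵐ[volume.restrict U] φ ∧ w.grad =ᵐ[volume.restrict U] gradient φ :=
  exists_H1_of_isWeakGradient (memLp_restrict_of_continuous hU hφ.continuous)
    (memLp_restrict_of_continuous hU (contDiff_gradient hφ).continuous)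
    (isWeakGradient_of_contDiff U hφ)

/-- A test function supported in `O` is also one for `Ω`, so restricting the pair (function,
gradient) preserves the defining identity. -/
lemma exists_isSobolevRestr {n : ℕ} {Ω O : Set (Euc n)} (hO : O ⊆ Ω) (w : H1 Ω) :
    ∃ y : H1 O, IsSobolevRestr w y := by
  have hle : (volume : Measure (Euc n)).restrict O ≤ volume.restrict Ω :=
    Measure.restrict_mono hO le_rfl
  obtain ⟨y, hy, -⟩ := exists_H1_of_isWeakGradient (U := O) (u := w.fn) (g := w.grad)
    ((Lp.memLp w.fn).mono_measure hle) ((Lp.memLp w.grad).mono_measure hle) (by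
      intro φ h1 h2 h3 v
      have t1 : tsupport (fun x => w.fn x * fderiv ℝ φ x v) ⊆ O :=
        (tsupport_mul_subset_right).trans
          ((tsupport_fderiv_apply_subset ℝ v).trans h3)
      have t2 : tsupport (fun x => inner ℝ (w.grad x) v * φ x) ⊆ O :=
        (tsupport_mul_subset_right).trans h3
      have := w.isWeakGradient φ h1 h2 (h3.trans hO) v
      rw [setIntegral_eq_of_tsupport (t1.trans hO), setIntegral_eq_of_tsupport (t2.trans hO)] at this
      rw [setIntegral_eq_of_tsupport t1, setIntegral_eq_of_tsupport t2, this])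
  exact ⟨y, hy⟩

/-! ### Multiplication by a cutoff function, combined with extension by zero -/

/-- The hypothesis `hχ` makes `O` relatively closed in `tsupport χ ∩ Ω`. Cutting `χ * φ` off outside
`O` therefore creates no jump at a boundary point of `O` inside `Ω`. -/
lemma tsupport_indicator_mul_subset {n : ℕ} {Ω O : Set (Euc n)} {χ φ : Euc n → ℝ}
    (hχ : tsupport χ ∩ Ω ∩ closure O ⊆ O) (hφ : tsupport φ ⊆ Ω) :
    tsupport (O.indicator fun x => χ x * φ x) ⊆ O ∩ tsupport φ := by
  have h1 : tsupport (O.indicator fun x => χ x * φ x) ⊆ tsupport χ ∩ tsupport φ ∩ closure O := by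
    apply closure_minimal _ (((isClosed_tsupport _).inter (isClosed_tsupport _)).inter
      isClosed_closure)
    intro x hx
    have hxO : x ∈ O := by
      by_contra h
      exact hx (indicator_of_notMem h _)
    rw [Function.mem_support, indicator_of_mem hxO] at hx
    exact ⟨⟨subset_tsupport _ (left_ne_zero_of_mul hx), subset_tsupport _ (right_ne_zero_of_mul hx)⟩,
      subset_closure hxO⟩
  intro x hx
  exact ⟨hχ ⟨⟨(h1 hx).1.1, hφ (h1 hx).1.2⟩, (h1 hx).2⟩, (h1 hx).1.2⟩

lemma contDiff_indicator_mul {n : ℕ} {Ω O : Set (Euc n)} (hO : IsOpen O) {χ φ : Euc n → ℝ}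
    (hχ : tsupport χ ∩ Ω ∩ closure O ⊆ O) (hφ : tsupport φ ⊆ Ω) (h1 : ContDiff ℝ ∞ χ)
    (h2 : ContDiff ℝ ∞ φ) : ContDiff ℝ ∞ (O.indicator fun x => χ x * φ x) := by
  rw [contDiff_iff_contDiffAt]
  intro x
  by_cases hx : x ∈ O
  · refine (h1.mul h2).contDiffAt.congr_of_eventuallyEq ?_
    filter_upwards [hO.mem_nhds hx] with y hy
    exact indicator_of_mem hy _
  · refine (contDiffAt_const (c := (0 : ℝ))).congr_of_eventuallyEq ?_
    apply notMem_tsupport_iff_eventuallyEq.mp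
    exact fun h => hx (tsupport_indicator_mul_subset hχ hφ h).1

lemma setIntegral_indicator_of_subset {n : ℕ} {Ω O : Set (Euc n)} (hO : MeasurableSet O)
    (hOΩ : O ⊆ Ω) (f : Euc n → ℝ) : ∫ x in Ω, O.indicator f x = ∫ x in O, f x := by
  rw [setIntegral_indicator hO, inter_eq_self_of_subset_right hOΩ]

lemma isWeakGradient_cutoff {n : ℕ} {Ω O : Set (Euc n)} (hO : IsOpen O) (hOΩ : O ⊆ Ω)
    {χ : Euc n → ℝ} (h1 : ContDiff ℝ ∞ χ)
    (hχ : tsupport χ ∩ Ω ∩ closure O ⊆ O) (w : H1 O) :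
    IsWeakGradient Ω (O.indicator fun x => χ x * w.fn x)
      (O.indicator fun x => χ x • w.grad x + w.fn x • gradient χ x) := by
  intro φ h2 h3 h4 v
  -- `θ` is an admissible test function on `O`; testing `w` with it and expanding the product rule
  -- gives the identity for `χ * w` on `Ω`.
  set θ := O.indicator fun x => χ x * φ x with hθ
  have hθs : ContDiff ℝ ∞ θ := contDiff_indicator_mul hO hχ h4 h1 h2
  have hθt : tsupport θ ⊆ O ∩ tsupport φ := tsupport_indicator_mul_subset hχ h4
  have hθc : HasCompactSupport θ :=
    h3.of_isClosed_subset (isClosed_tsupport _) (hθt.trans inter_subset_right)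
  have key := w.isWeakGradient θ hθs hθc (hθt.trans inter_subset_left) v
  have hfd : ∀ x ∈ O, fderiv ℝ θ x v = χ x * fderiv ℝ φ x v + φ x * fderiv ℝ χ x v := by
    intro x hx
    have : θ =ᶠ[𝓝 x] fun x => χ x * φ x := by
      filter_upwards [hO.mem_nhds hx] with y hy
      exact indicator_of_mem hy _
    rw [this.fderiv_eq, fderiv_fun_mul (h1.differentiable (by simp) x)
      (h2.differentiable (by simp) x)]
    simp
  have e1 : ∫ x in Ω, (O.indicator fun x => χ x * w.fn x) x * fderiv ℝ φ x v
      = ∫ x in O, χ x * w.fn x * fderiv ℝ φ x v := by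
    rw [← setIntegral_indicator_of_subset hO.measurableSet hOΩ]
    congr 1 with x
    by_cases hx : x ∈ O <;> simp [hx]
  have e2 : ∫ x in Ω, inner ℝ ((O.indicator fun x => χ x • w.grad x + w.fn x • gradient χ x) x) v
        * φ x = ∫ x in O, inner ℝ (χ x • w.grad x + w.fn x • gradient χ x) v * φ x := by
    rw [← setIntegral_indicator_of_subset hO.measurableSet hOΩ]
    congr 1 with x
    by_cases hx : x ∈ O <;> simp [hx]
  have e3 : ∫ x in O, inner ℝ (w.grad x) v * θ x = ∫ x in O, inner ℝ (w.grad x) v * (χ x * φ x) := by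
    apply setIntegral_congr_fun hO.measurableSet
    intro x hx
    simp [hθ, hx]
  have e4 : ∫ x in O, w.fn x * fderiv ℝ θ x v
      = ∫ x in O, w.fn x * (χ x * fderiv ℝ φ x v + φ x * fderiv ℝ χ x v) := by
    apply setIntegral_congr_fun hO.measurableSet
    intro x hx
    simp [hfd x hx]
  have cφ : Continuous fun x => fderiv ℝ φ x v :=
    (h2.continuous_fderiv (by simp)).clm_apply continuous_const
  have cχ : Continuous fun x => fderiv ℝ χ x v :=
    (h1.continuous_fderiv (by simp)).clm_apply continuous_const
  have i1 : Integrable (fun x => w.fn x * (χ x * fderiv ℝ φ x v)) (volume.restrict O) :=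
    MemLp.integrable_mul (p := 2) (q := 2) (Lp.memLp w.fn)
      (memLp_of_test O (h1.continuous.mul cφ) (h3.fderiv_apply (𝕜 := ℝ) v).mul_left)
  have i2 : Integrable (fun x => w.fn x * (φ x * fderiv ℝ χ x v)) (volume.restrict O) :=
    MemLp.integrable_mul (p := 2) (q := 2) (Lp.memLp w.fn)
      (memLp_of_test O (h2.continuous.mul cχ) h3.mul_right)
  have i3 : Integrable (fun x => inner ℝ (w.grad x) v * (χ x * φ x)) (volume.restrict O) :=
    MemLp.integrable_mul (p := 2) (q := 2) ((Lp.memLp w.grad).inner_const v)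
      (memLp_of_test O (h1.continuous.mul h2.continuous) h3.mul_left)
  rw [e3, e4] at key
  rw [e1, e2]
  simp_rw [mul_add] at key
  rw [integral_add i1 i2] at key
  have e5 : ∫ x in O, inner ℝ (χ x • w.grad x + w.fn x • gradient χ x) v * φ x
      = (∫ x in O, inner ℝ (w.grad x) v * (χ x * φ x))
        + ∫ x in O, w.fn x * (φ x * fderiv ℝ χ x v) := by
    rw [← integral_add i3 i2]
    congr 1 with x
    rw [inner_add_left, real_inner_smul_left, real_inner_smul_left, inner_gradient]
    ring
  rw [e5]
  have e6 : ∫ x in O, χ x * w.fn x * fderiv ℝ φ x v = ∫ x in O, w.fn x * (χ x * fderiv ℝ φ x v) := by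
    congr 1 with x
    ring
  rw [e6]
  linarith

lemma memLp_indicator_of_subset {n : ℕ} {Ω O : Set (Euc n)} (hO : MeasurableSet O)
    (hOΩ : O ⊆ Ω) {F : Type*} [NormedAddCommGroup F] {f : Euc n → F}
    (hf : MemLp f 2 ((volume : Measure (Euc n)).restrict O)) :
    MemLp (O.indicator f) 2 ((volume : Measure (Euc n)).restrict Ω) := by
  rw [memLp_indicator_iff_restrict hO, Measure.restrict_restrict hO,
    inter_eq_self_of_subset_left hOΩ]
  exact hf

lemma norm_le_of_ae_eq_indicator {n : ℕ} {Ω O : Set (Euc n)} (hO : MeasurableSet O)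
    (hOΩ : O ⊆ Ω) {F : Type*} [NormedAddCommGroup F] {f : Euc n → F} {c : ℝ} (hc : 0 ≤ c)
    {q : Lp F 2 ((volume : Measure (Euc n)).restrict Ω)}
    (hq : q =ᵐ[volume.restrict Ω] O.indicator f)
    {G : Type*} [NormedAddCommGroup G] {v : Lp G 2 ((volume : Measure (Euc n)).restrict O)}
    (hf : ∀ x, ‖f x‖ ≤ c * ‖v x‖) : ‖q‖ ≤ c * ‖v‖ := by
  rw [Lp.norm_def, Lp.norm_def, ← ENNReal.toReal_ofReal hc, ← ENNReal.toReal_mul]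
  apply ENNReal.toReal_mono
    (ENNReal.mul_ne_top ENNReal.ofReal_ne_top (Lp.eLpNorm_ne_top v))
  rw [eLpNorm_congr_ae hq, eLpNorm_indicator_eq_eLpNorm_restrict hO, Measure.restrict_restrict hO,
    inter_eq_self_of_subset_left hOΩ]
  exact eLpNorm_le_mul_eLpNorm_of_ae_le_mul (Eventually.of_forall hf) 2

/-- Used twice: with `O = Ω` for a partition of unity, and with `O = ω_r` to extend functions of
`H¹(ω_r)` to `Ω`. -/
theorem exists_cutoff {n : ℕ} {Ω O : Set (Euc n)} (hO : IsOpen O) (hOΩ : O ⊆ Ω)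
    {χ : Euc n → ℝ} (h1 : ContDiff ℝ ∞ χ) (hc : HasCompactSupport χ)
    (hχ : tsupport χ ∩ Ω ∩ closure O ⊆ O) :
    ∃ L : H1 O →L[ℝ] H1 Ω, ∀ w : H1 O,
      (L w).fn =ᵐ[volume.restrict Ω] (O.indicator fun x => χ x * w.fn x) ∧
      (L w).grad =ᵐ[volume.restrict Ω]
        (O.indicator fun x => χ x • w.grad x + w.fn x • gradient χ x) := by
  obtain ⟨M, hM⟩ := hc.exists_bound_of_continuous h1.continuous
  have hgc : HasCompactSupport (gradient χ) := by
    have := hc.fderiv (𝕜 := ℝ)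
    exact this.comp_left (g := (InnerProductSpace.toDual ℝ (Euc n)).symm) (map_zero _)
  obtain ⟨M', hM'⟩ := hgc.exists_bound_of_continuous (contDiff_gradient h1).continuous
  have hM0 : 0 ≤ M := (norm_nonneg _).trans (hM 0)
  have hM0' : 0 ≤ M' := (norm_nonneg _).trans (hM' 0)
  have m1 : ∀ w : H1 O, MemLp (fun x => χ x * w.fn x) 2 (volume.restrict O) := fun w =>
    (Lp.memLp w.fn).of_le_mul (c := M)
      (h1.continuous.aestronglyMeasurable.mul (Lp.aestronglyMeasurable _))
      (Eventually.of_forall fun x => by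
        rw [norm_mul]
        exact mul_le_mul_of_nonneg_right (hM x) (norm_nonneg _))
  have m2 : ∀ w : H1 O, MemLp (fun x => χ x • w.grad x) 2 (volume.restrict O) := fun w =>
    (Lp.memLp w.grad).of_le_mul (c := M)
      (h1.continuous.aestronglyMeasurable.smul (Lp.aestronglyMeasurable _))
      (Eventually.of_forall fun x => by
        rw [norm_smul]
        exact mul_le_mul_of_nonneg_right (hM x) (norm_nonneg _))
  have m3 : ∀ w : H1 O, MemLp (fun x => w.fn x • gradient χ x) 2 (volume.restrict O) := fun w =>
    (Lp.memLp w.fn).of_le_mul (c := M')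
      ((Lp.aestronglyMeasurable w.fn).smul (contDiff_gradient h1).continuous.aestronglyMeasurable)
      (Eventually.of_forall fun x => by
        rw [norm_smul, mul_comm]
        exact mul_le_mul_of_nonneg_right (hM' x) (norm_nonneg _))
  have hOm := hO.measurableSet
  choose L hL1 hL2 using fun w : H1 O => exists_H1_of_isWeakGradient
    (memLp_indicator_of_subset hOm hOΩ (m1 w))
    (memLp_indicator_of_subset hOm hOΩ ((m2 w).add (m3 w)))
    (isWeakGradient_cutoff hO hOΩ h1 hχ w)
  have lift : ∀ {P : Euc n → Prop}, (∀ᵐ x ∂(volume : Measure (Euc n)).restrict O, P x) →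
      ∀ᵐ x ∂(volume : Measure (Euc n)).restrict Ω, x ∈ O → P x := fun {P} h => by
    have := (ae_restrict_iff' hOm).1 h
    exact ae_restrict_of_ae this
  have hadd : ∀ v w, L (v + w) = L v + L w := by
    intro v w
    apply H1.ext'
    · filter_upwards [hL1 v, hL1 w, hL1 (v + w), H1.coeFn_fn_add (L v) (L w),
        lift (H1.coeFn_fn_add v w)] with x e1 e2 e3 e4 e5
      by_cases hx : x ∈ O
      · have e5 := e5 hx
        simp [hx] at e1 e2 e3 e4 e5
        rw [e3, e4, e1, e2, e5]; ring
      · simp [hx] at e1 e2 e3 e4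
        rw [e3, e4, e1, e2]; ring
    · filter_upwards [hL2 v, hL2 w, hL2 (v + w), H1.coeFn_grad_add (L v) (L w),
        lift (H1.coeFn_fn_add v w), lift (H1.coeFn_grad_add v w)] with x e1 e2 e3 e4 e5 e6
      by_cases hx : x ∈ O
      · have e5 := e5 hx
        have e6 := e6 hx
        simp [hx] at e1 e2 e3 e4 e5 e6
        rw [e3, e4, e1, e2, e5, e6]; module
      · simp [hx] at e1 e2 e3 e4
        rw [e3, e4, e1, e2]; module
  have hsmul : ∀ (c : ℝ) w, L (c • w) = c • L w := by
    intro c w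
    apply H1.ext'
    · filter_upwards [hL1 w, hL1 (c • w), H1.coeFn_fn_smul c (L w),
        lift (H1.coeFn_fn_smul c w)] with x e1 e3 e4 e5
      by_cases hx : x ∈ O
      · have e5 := e5 hx
        simp [hx] at e1 e3 e4 e5
        rw [e3, e4, e1, e5]; ring
      · simp [hx] at e1 e3 e4
        rw [e3, e4, e1]; ring
    · filter_upwards [hL2 w, hL2 (c • w), H1.coeFn_grad_smul c (L w),
        lift (H1.coeFn_fn_smul c w), lift (H1.coeFn_grad_smul c w)] with x e1 e3 e4 e5 e6
      by_cases hx : x ∈ O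
      · have e5 := e5 hx
        have e6 := e6 hx
        simp [hx] at e1 e3 e4 e5 e6
        rw [e3, e4, e1, e5, e6]; module
      · simp [hx] at e1 e3 e4
        rw [e3, e4, e1]; module
  -- One `M` bounds `χ * w`, the other `χ • ∇w`, and `M'` bounds `w • ∇χ`.
  have bound : ∀ w, ‖L w‖ ≤ (2 * M + M') * ‖w‖ := by
    intro w
    have b1 : ‖(L w).fn‖ ≤ M * ‖w.fn‖ := by
      apply norm_le_of_ae_eq_indicator hOm hOΩ hM0 (hL1 w)
      intro x
      rw [norm_mul]
      exact mul_le_mul_of_nonneg_right (hM x) (norm_nonneg _)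
    have b2 : ‖(L w).grad‖ ≤ M * ‖w.grad‖ + M' * ‖w.fn‖ := by
      have k2 := memLp_indicator_of_subset hOm hOΩ (m2 w)
      have k3 := memLp_indicator_of_subset hOm hOΩ (m3 w)
      have : (L w).grad = k2.toLp _ + k3.toLp _ := by
        apply Lp.ext
        filter_upwards [hL2 w, Lp.coeFn_add (k2.toLp _) (k3.toLp _), k2.coeFn_toLp,
          k3.coeFn_toLp] with x e1 e2 e3 e4
        rw [e1, e2, Pi.add_apply, e3, e4]
        by_cases hx : x ∈ O <;> simp [hx]
      rw [this]
      refine (norm_add_le _ _).trans (add_le_add ?_ ?_)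
      · apply norm_le_of_ae_eq_indicator hOm hOΩ hM0 k2.coeFn_toLp
        intro x
        rw [norm_smul]
        exact mul_le_mul_of_nonneg_right (hM x) (norm_nonneg _)
      · apply norm_le_of_ae_eq_indicator hOm hOΩ hM0' k3.coeFn_toLp
        intro x
        rw [norm_smul, mul_comm]
        exact mul_le_mul_of_nonneg_right (hM' x) (norm_nonneg _)
    have := (L w).norm_le_add
    have c1 := mul_le_mul_of_nonneg_left w.norm_fn_le hM0
    have c2 := mul_le_mul_of_nonneg_left w.norm_grad_le hM0
    have c3 := mul_le_mul_of_nonneg_left w.norm_fn_le hM0'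
    linarith
  exact ⟨LinearMap.mkContinuous ⟨⟨L, hadd⟩, hsmul⟩ _ bound, fun w => ⟨hL1 w, hL2 w⟩⟩

theorem exists_mul_cutoff {n : ℕ} {Ω : Set (Euc n)} (hΩ : IsOpen Ω)
    {χ : Euc n → ℝ} (h1 : ContDiff ℝ ∞ χ) (hc : HasCompactSupport χ) :
    ∃ L : H1 Ω →L[ℝ] H1 Ω, ∀ w : H1 Ω,
      (L w).fn =ᵐ[volume.restrict Ω] (fun x => χ x * w.fn x) ∧
      (L w).grad =ᵐ[volume.restrict Ω] (fun x => χ x • w.grad x + w.fn x • gradient χ x) := by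
  obtain ⟨L, hL⟩ := exists_cutoff hΩ Subset.rfl h1 hc
    (inter_subset_left.trans inter_subset_right)
  refine ⟨L, fun w => ⟨?_, ?_⟩⟩
  · exact (hL w).1.trans ((ae_restrict_mem hΩ.measurableSet).mono fun x hx => by simp [hx])
  · exact (hL w).2.trans ((ae_restrict_mem hΩ.measurableSet).mono fun x hx => by simp [hx])


/-! ### Boundary charts and the `W^{1,1}` trace inequality for smooth functions -/

/-- Orthogonal coordinates of `ℝ^{m+1}` adapted to a unit vector `ν`. -/
theorem exists_adapted_coordinates {m : ℕ} {ν : Euc (m + 1)} (hν : ‖ν‖ = 1) :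
    ∃ P : (ℝ × (Fin m → ℝ)) →L[ℝ] Euc (m + 1), MeasurePreserving P ∧
      Function.Surjective P ∧ (P (1, 0) = ν) ∧ (∀ q, inner ℝ (P q) ν = q.1) ∧
      ∀ q, ‖q‖ ≤ ‖P q‖ := by
  obtain ⟨b, hb⟩ := Orthonormal.exists_orthonormalBasis_extension_of_card_eq (𝕜 := ℝ)
    (E := Euc (m + 1)) (ι := Fin (m + 1)) (by simp) (v := fun _ => ν) (s := {0})
    (by
      refine ⟨fun _ => by simpa using hν, fun i j hij => ?_⟩
      exact absurd (Subsingleton.elim i j) hij)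
  have hb0 : b 0 = ν := hb 0 rfl
  let e := (MeasurableEquiv.piFinSuccAbove (fun _ : Fin (m + 1) => ℝ) 0).symm
  have he : MeasurePreserving e :=
    (volume_preserving_piFinSuccAbove (fun _ : Fin (m + 1) => ℝ) 0).symm _
  have h2 : MeasurePreserving (WithLp.toLp 2 : (Fin (m + 1) → ℝ) → Euc (m + 1)) :=
    PiLp.volume_preserving_toLp (Fin (m + 1))
  have h3 := b.measurePreserving_repr_symm
  let P₀ : (ℝ × (Fin m → ℝ)) →ₗ[ℝ] Euc (m + 1) :=
    { toFun := fun q => b.repr.symm (WithLp.toLp 2 (Fin.cons q.1 q.2))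
      map_add' := fun q q' => by
        rw [← map_add, ← WithLp.toLp_add]
        congr 2
        ext i
        refine Fin.cases ?_ (fun j => ?_) i <;> simp
      map_smul' := fun c q => by
        rw [RingHom.id_apply, ← map_smul, ← WithLp.toLp_smul]
        congr 2
        ext i
        refine Fin.cases ?_ (fun j => ?_) i <;> simp }
  let P : (ℝ × (Fin m → ℝ)) →L[ℝ] Euc (m + 1) := LinearMap.toContinuousLinearMap P₀
  have hP : ∀ q, P q = b.repr.symm (WithLp.toLp 2 (Fin.cons q.1 q.2)) := fun q => rfl
  refine ⟨P, ?_, ?_, ?_, ?_, ?_⟩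
  · have : (P : ℝ × (Fin m → ℝ) → Euc (m + 1)) = b.repr.symm ∘ WithLp.toLp 2 ∘ e := by
      ext1 q
      rw [hP]
      simp only [Function.comp_apply]
      congr 2
      simp [e, MeasurableEquiv.piFinSuccAbove, Fin.insertNthEquiv]
    rw [this]
    exact h3.comp (h2.comp he)
  · intro y
    refine ⟨(b.repr y 0, fun i => b.repr y i.succ), ?_⟩
    rw [hP, LinearIsometryEquiv.symm_apply_eq]
    ext i
    refine Fin.cases ?_ (fun j => ?_) i <;> simp
  · rw [hP, LinearIsometryEquiv.symm_apply_eq, ← hb0]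
    ext i
    refine Fin.cases ?_ (fun j => ?_) i <;> simp
  · intro q
    rw [hP, ← hb0, real_inner_comm, ← b.repr_apply_apply]
    simp
  -- The coordinate space carries the sup norm, so `P` only dominates the norm and is not an
  -- isometry.
  · intro q
    rw [hP, LinearIsometryEquiv.norm_map]
    have h := fun i : Fin (m + 1) => PiLp.norm_apply_le (p := 2)
      (WithLp.toLp 2 (Fin.cons q.1 q.2) : Euc (m + 1)) i
    refine max_le ?_ ((pi_norm_le_iff_of_nonneg (norm_nonneg _)).2 fun i => ?_)
    · simpa using h 0
    · simpa using h i.succ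

/-- Strictly below the graph a point has a neighbourhood disjoint from `Ω`; strictly above it the
point lies in the open set `Ω`. Neither can be a boundary point. -/
lemma frontier_subset_graph {n : ℕ} {Ω : Set (Euc n)} (hΩ : IsOpen Ω) {ν x : Euc n}
    {γ : Euc n → ℝ} {ρ : ℝ} (hγ : Continuous γ)
    (h : Ω ∩ Metric.ball x ρ = {y | y ∈ Metric.ball x ρ ∧ γ y < inner ℝ y ν}) :
    frontier Ω ∩ Metric.ball x ρ ⊆ {y | γ y = inner ℝ y ν} := by
  rintro y ⟨hy, hyb⟩
  rw [hΩ.frontier_eq] at hy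
  apply le_antisymm
  · by_contra! hlt
    have ho : IsOpen {z | z ∈ Metric.ball x ρ ∧ inner ℝ z ν < γ z} :=
      Metric.isOpen_ball.inter (isOpen_lt (by fun_prop) hγ)
    obtain ⟨z, hz1, hz2⟩ := mem_closure_iff.1 hy.1 _ ho ⟨hyb, hlt⟩
    have : z ∈ Ω ∩ Metric.ball x ρ := ⟨hz2, hz1.1⟩
    rw [h] at this
    exact lt_asymm this.2 hz1.2
  · by_contra! hlt
    have : y ∈ Ω ∩ Metric.ball x ρ := by
      rw [h]
      exact ⟨hyb, hlt⟩
    exact hy.2 this.1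

/-- Fundamental theorem of calculus along the ray in direction `ν`, at whose far end `f` vanishes.
-/
lemma enorm_le_lintegral_Ioi_fderiv {n : ℕ} {f : Euc n → ℝ} (hf : ContDiff ℝ 1 f)
    (hc : HasCompactSupport f) {ν : Euc n} (hν : ‖ν‖ = 1) (y : Euc n) :
    ‖f y‖ₑ ≤ ∫⁻ s in Ioi (0 : ℝ), ‖fderiv ℝ f (y + s • ν) ν‖ₑ := by
  have hemb : Topology.IsClosedEmbedding fun s : ℝ => y + s • ν := by
    apply Isometry.isClosedEmbedding
    apply Isometry.of_dist_eq
    intro a b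
    rw [dist_add_left, dist_eq_norm, ← sub_smul, norm_smul, hν, mul_one, dist_eq_norm]
  have h1 : ContDiff ℝ 1 fun s : ℝ => f (y + s • ν) := by fun_prop
  have h2 : HasCompactSupport fun s : ℝ => f (y + s • ν) := hc.comp_isClosedEmbedding hemb
  have h3 := h2.integral_Ioi_deriv_eq h1 0
  have h4 : ∀ s : ℝ, deriv (fun s : ℝ => f (y + s • ν)) s = fderiv ℝ f (y + s • ν) ν := by
    intro s
    have a : HasDerivAt (fun s : ℝ => y + s • ν) ν s := by
      simpa using ((hasDerivAt_id s).smul_const ν).const_add y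
    exact ((hf.differentiable (by simp) (y + s • ν)).hasFDerivAt.comp_hasDerivAt s a).deriv
  simp_rw [h4] at h3
  have h5 : ‖f y‖ₑ = ‖∫ s in Ioi (0 : ℝ), fderiv ℝ f (y + s • ν) ν‖ₑ := by
    rw [h3]; simp
  rw [h5]
  exact enorm_integral_le_lintegral_enorm _

/-- In the chart the boundary is the image of a Lipschitz graph map `G`, so its Hausdorff measure is
at most `L ^ m` times the image of Lebesgue measure; no lower bound is needed. Integrating `∂_ν f`
along the rays that start on the graph and applying Tonelli gives the integral over the region above
the graph. -/
theorem exists_local_trace_inequality {m : ℕ} {Ω : Set (Euc (m + 1))} (hΩ : IsOpen Ω)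
    (hS : HasSmoothBoundary Ω) {x : Euc (m + 1)} (hx : x ∈ frontier Ω) :
    ∃ (ν : Euc (m + 1)) (ρ : ℝ) (C : ℝ≥0∞), 0 < ρ ∧ C ≠ ⊤ ∧
      surf (frontier Ω) (Metric.ball x ρ) < ⊤ ∧
      ∀ f : Euc (m + 1) → ℝ, ContDiff ℝ 1 f → tsupport f ⊆ Metric.ball x ρ →
        ∫⁻ y, ‖f y‖ₑ ∂surf (frontier Ω) ≤ C * ∫⁻ y in Ω, ‖fderiv ℝ f y ν‖ₑ := by
  obtain ⟨ν, γ, ρ, hν, hγ, hγν, hρ, hball⟩ := hS x hx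
  obtain ⟨P, hPm, hPs, hP1, hPi, hPn⟩ := exists_adapted_coordinates hν
  have hPadd : ∀ (s t : ℝ) (a : Fin m → ℝ), P (s + t, a) = P (s, a) + t • ν := by
    intro s t a
    rw [← hP1, ← map_smul, ← map_add]
    simp
  have hγP : ∀ (s : ℝ) (a : Fin m → ℝ), γ (P (s, a)) = γ (P (0, a)) := by
    intro s a
    have := hPadd 0 s a
    rw [zero_add] at this
    rw [this, hγν]
  let g : (Fin m → ℝ) → ℝ := fun a => γ (P (0, a))
  have hg : ContDiff ℝ ∞ g := hγ.comp (P.contDiff.comp (contDiff_const.prodMk contDiff_id))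
  let G : (Fin m → ℝ) → Euc (m + 1) := fun a => P (g a, a)
  have hG : ContDiff ℝ ∞ G := P.contDiff.comp (hg.prodMk contDiff_id)
  -- Since `‖a‖ ≤ ‖P (s, a)‖`, this ball contains the horizontal coordinates of all points of
  -- `Metric.ball x ρ`.
  let K : Set (Fin m → ℝ) := Metric.closedBall 0 (‖x‖ + ρ)
  have hK : IsCompact K := isCompact_closedBall _ _
  have hsub : frontier Ω ∩ Metric.ball x ρ ⊆ G '' K := by
    rintro y ⟨hy1, hy2⟩
    have hgr : γ y = inner ℝ y ν := frontier_subset_graph hΩ hγ.continuous hball ⟨hy1, hy2⟩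
    obtain ⟨⟨s, a⟩, rfl⟩ := hPs y
    rw [hPi, hγP] at hgr
    refine ⟨a, ?_, ?_⟩
    · rw [Metric.mem_ball, dist_eq_norm] at hy2
      rw [mem_closedBall_zero_iff]
      have h1 : ‖a‖ ≤ ‖P (s, a)‖ := (le_max_right _ _).trans (hPn (s, a))
      have h2 := norm_sub_norm_le (P (s, a)) x
      linarith
    · change P (γ (P (0, a)), a) = _
      rw [hgr]
  obtain ⟨L, hL⟩ := (hG.of_le (n := ∞) (m := 1) (by simp)).locallyLipschitz.locallyLipschitzOn
    (s := K) |>.exists_lipschitzOnWith_of_compact hK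
  set C : ℝ≥0∞ := (L : ℝ≥0∞) ^ (m : ℝ) with hC
  have hCtop : C ≠ ⊤ := ENNReal.rpow_ne_top_of_nonneg (Nat.cast_nonneg m) ENNReal.coe_ne_top
  have hdim : ((m + 1 : ℕ) : ℝ) - 1 = m := by push_cast; ring
  have hvol : (Measure.hausdorffMeasure (m : ℝ) : Measure (Fin m → ℝ)) = volume := by
    simpa using hausdorffMeasure_pi_real (ι := Fin m)
  have himage : ∀ A ⊆ K, Measure.hausdorffMeasure (((m + 1 : ℕ) : ℝ) - 1) (G '' A)
      ≤ C * volume A := by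
    intro A hA
    rw [hdim, ← hvol]
    exact (hL.mono hA).hausdorffMeasure_image_le (by positivity)
  have hmeas : (surf (frontier Ω)).restrict (Metric.ball x ρ)
      ≤ C • (volume.restrict K).map G := by
    refine Measure.le_iff.2 fun E hE => ?_
    rw [Measure.restrict_apply hE, surf, Measure.restrict_apply (hE.inter measurableSet_ball),
      Measure.smul_apply, Measure.map_apply hG.continuous.measurable hE,
      Measure.restrict_apply (hG.continuous.measurable hE), smul_eq_mul]
    refine (measure_mono ?_).trans (himage (G ⁻¹' E ∩ K) inter_subset_right)
    rintro y ⟨⟨hyE, hyb⟩, hyf⟩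
    obtain ⟨a, ha, rfl⟩ := hsub ⟨hyf, hyb⟩
    exact ⟨a, ⟨hyE, ha⟩, rfl⟩
  refine ⟨ν, ρ, C, hρ, hCtop, ?_, ?_⟩
  · rw [surf, Measure.restrict_apply measurableSet_ball, inter_comm]
    refine (measure_mono hsub).trans_lt ((himage K Subset.rfl).trans_lt ?_)
    exact ENNReal.mul_lt_top hCtop.lt_top hK.measure_lt_top
  intro f hf hfs
  have hc : HasCompactSupport f := by
    refine (isCompact_closedBall x ρ).of_isClosed_subset (isClosed_tsupport f) ?_
    exact hfs.trans Metric.ball_subset_closedBall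
  let F : Euc (m + 1) → ℝ≥0∞ := fun y => ‖fderiv ℝ f y ν‖ₑ
  have hFc : Continuous fun y => fderiv ℝ f y ν :=
    (hf.continuous_fderiv (by simp)).clm_apply continuous_const
  have hFm : Measurable F := hFc.measurable.enorm
  have hFs : ∀ y, y ∉ Metric.ball x ρ → F y = 0 := by
    intro y hy
    have : y ∉ tsupport fun z => fderiv ℝ f z ν :=
      fun h => hy (hfs (tsupport_fderiv_apply_subset ℝ ν h))
    simp [F, image_eq_zero_of_notMem_tsupport this]
  have hΓm : MeasurableSet {y : Euc (m + 1) | γ y < inner ℝ y ν} :=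
    (isOpen_lt hγ.continuous (by fun_prop)).measurableSet
  calc ∫⁻ y, ‖f y‖ₑ ∂surf (frontier Ω)
      = ∫⁻ y in Metric.ball x ρ, ‖f y‖ₑ ∂surf (frontier Ω) := by
        rw [← lintegral_indicator measurableSet_ball]
        congr 1 with y
        by_cases hy : y ∈ Metric.ball x ρ
        · simp [hy]
        · simp [hy, image_eq_zero_of_notMem_tsupport fun h => hy (hfs h)]
    _ ≤ ∫⁻ y, ‖f y‖ₑ ∂(C • (volume.restrict K).map G) := lintegral_mono' hmeas le_rfl
    _ = C * ∫⁻ a in K, ‖f (G a)‖ₑ := by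
        rw [lintegral_smul_measure, lintegral_map hf.continuous.measurable.enorm
          hG.continuous.measurable, smul_eq_mul]
    _ ≤ C * ∫⁻ a, ∫⁻ s, (Ioi (g a)).indicator (fun s => F (P (s, a))) s := by
        refine mul_le_mul_right ?_ C
        refine (setLIntegral_le_lintegral _ _).trans (lintegral_mono fun a => ?_)
        refine (enorm_le_lintegral_Ioi_fderiv hf hc hν _).trans (le_of_eq ?_)
        have h := (measurePreserving_add_left volume (g a)).setLIntegral_comp_preimage
          (f := fun s => F (P (s, a))) (measurableSet_Ioi (a := g a))
          (hFm.comp (P.continuous.measurable.comp measurable_prodMk_right))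
        have : (fun s => g a + s) ⁻¹' Ioi (g a) = Ioi 0 := by
          ext s; simp
        rw [lintegral_indicator measurableSet_Ioi, ← h, this]
        simp only [F, hPadd, G]
    _ = C * ∫⁻ q : ℝ × (Fin m → ℝ), {y | γ y < inner ℝ y ν}.indicator F (P q) := by
        congr 1
        rw [Measure.volume_eq_prod, lintegral_prod_symm
          (fun q => {y | γ y < inner ℝ y ν}.indicator F (P q)) ((hFm.indicator hΓm).comp P.continuous.measurable).aemeasurable]
        refine lintegral_congr fun a => lintegral_congr fun s => ?_
        simp only [indicator, mem_Ioi, mem_ofPred_eq, hPi, hγP s a, g]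
    _ = C * ∫⁻ y in {y | γ y < inner ℝ y ν}, F y := by
        rw [hPm.lintegral_comp (hFm.indicator hΓm), lintegral_indicator hΓm]
    -- `F` vanishes off the ball, and inside the ball `Ω` is exactly the region above the graph.
    _ = C * ∫⁻ y in Ω, F y := by
        congr 1
        rw [← lintegral_indicator hΓm, ← lintegral_indicator hΩ.measurableSet]
        congr 1 with y
        by_cases hy : y ∈ Metric.ball x ρ
        · have : y ∈ Ω ↔ γ y < inner ℝ y ν := by
            have := Set.ext_iff.1 hball y
            simpa [Metric.mem_ball.1 hy] using this
          simp [indicator, this]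
        · simp [indicator, hFs y hy]


/-! ### Uniqueness of weak gradients -/

/-- The fundamental lemma of the calculus of variations, with vector values tested one direction at
a time. -/
lemma IsWeakGradient.ae_eq {n : ℕ} {U : Set (Euc n)} (hU : IsOpen U) {u : Euc n → ℝ}
    {g g' : Euc n → Euc n} (hg : MemLp g 2 (volume.restrict U))
    (hg' : MemLp g' 2 (volume.restrict U)) (h : IsWeakGradient U u g)
    (h' : IsWeakGradient U u g') : g =ᵐ[volume.restrict U] g' := by
  have hL2 : MemLp (g - g') 2 (volume.restrict U) := hg.sub hg'
  have hL : LocallyIntegrableOn (g - g') U := by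
    apply locallyIntegrableOn_of_locallyIntegrable_restrict
    exact hL2.locallyIntegrable (by norm_num)
  have := hU.ae_eq_zero_of_integral_contDiff_smul_eq_zero hL (by
    intro φ h1 h2 h3
    have hφ : ∀ {f : Euc n → Euc n}, MemLp f 2 (volume.restrict U) → ∀ v : Euc n,
        Integrable (fun x => inner ℝ (f x) v * φ x) (volume.restrict U) := fun hf v =>
      MemLp.integrable_mul (p := 2) (q := 2) (hf.inner_const v) (memLp_of_test U h1.continuous h2)
    have hi : Integrable (fun x => φ x • (g - g') x) (volume.restrict U) :=
      ContinuousLinearMap.memLp_of_bilin 1 (ContinuousLinearMap.lsmul ℝ ℝ)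
        (memLp_of_test U h1.continuous h2) hL2 |> memLp_one_iff_integrable.1
    have hU' : ∫ x in U, φ x • (g - g') x = ∫ x, φ x • (g - g') x :=
      setIntegral_eq_integral_of_forall_compl_eq_zero fun x hx => by
        rw [image_eq_zero_of_notMem_tsupport fun h' => hx (h3 h'), zero_smul]
    rw [← hU']
    refine ext_inner_left ℝ fun v => ?_
    rw [← integral_inner hi, inner_zero_right]
    have e := (h φ h1 h2 h3 v).symm.trans (h' φ h1 h2 h3 v)
    have e2 : ∀ x, inner ℝ v (φ x • (g - g') x)
        = inner ℝ (g x) v * φ x - inner ℝ (g' x) v * φ x := by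
      intro x
      rw [inner_smul_right, Pi.sub_apply, inner_sub_right, real_inner_comm, real_inner_comm (g' x)]
      ring
    simp_rw [e2]
    rw [integral_sub (hφ hg v) (hφ hg' v)]
    linarith)
  rw [Filter.EventuallyEq, ae_restrict_iff' hU.measurableSet]
  filter_upwards [this] with x hx hxU
  exact sub_eq_zero.1 (hx hxU)

lemma H1.grad_ae_eq {n : ℕ} {U : Set (Euc n)} (hU : IsOpen U) (hb : Bornology.IsBounded U)
    {w : H1 U} {φ : Euc n → ℝ} (hφ : ContDiff ℝ ∞ φ) (h : w.fn =ᵐ[volume.restrict U] φ) :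
    w.grad =ᵐ[volume.restrict U] gradient φ :=
  IsWeakGradient.ae_eq hU (Lp.memLp _)
    (memLp_restrict_of_continuous hb (contDiff_gradient hφ).continuous)
    (w.isWeakGradient.congr h .rfl) (isWeakGradient_of_contDiff U hφ)

/-! ### Continuous bilinear expressions -/

/-- The product `L² × L² → L¹`. -/
noncomputable def mulL1 {α : Type*} {m : MeasurableSpace α} (μ : Measure α) :
    Lp ℝ 2 μ →L[ℝ] Lp ℝ 2 μ →L[ℝ] Lp ℝ 1 μ :=
  (ContinuousLinearMap.mul ℝ ℝ).holderL μ 2 2 1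

lemma coeFn_mulL1 {α : Type*} {m : MeasurableSpace α} (μ : Measure α) (f g : Lp ℝ 2 μ) :
    mulL1 μ f g =ᵐ[μ] fun x => f x * g x :=
  ContinuousLinearMap.coeFn_holder _ f g

lemma exists_mul_L2 {n : ℕ} (μ : Measure (Euc n)) {χ : Euc n → ℝ} (h : Continuous χ)
    (hc : HasCompactSupport χ) :
    ∃ M : Lp ℝ 2 μ →L[ℝ] Lp ℝ 2 μ, ∀ f, M f =ᵐ[μ] fun x => χ x * f x := by
  obtain ⟨C, hC⟩ := hc.exists_bound_of_continuous h
  have hm : MemLp χ ⊤ μ := memLp_top_of_bound h.aestronglyMeasurable C (Eventually.of_forall hC)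
  refine ⟨(ContinuousLinearMap.mul ℝ ℝ).holderL μ ⊤ 2 2 (hm.toLp χ), fun f => ?_⟩
  filter_upwards [ContinuousLinearMap.coeFn_holder (r := 2) (ContinuousLinearMap.mul ℝ ℝ)
    (hm.toLp χ) f, hm.coeFn_toLp] with x h1 h2
  rw [ContinuousLinearMap.holderL_apply_apply, h1, h2]
  rfl

lemma H1.continuous_fn {n : ℕ} {U : Set (Euc n)} : Continuous (H1.fn : H1 U → _) :=
  (WithLp.prod_continuous_ofLp 2 _ _).fst.comp continuous_subtype_val

lemma H1.continuous_grad {n : ℕ} {U : Set (Euc n)} : Continuous (H1.grad : H1 U → _) :=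
  (WithLp.prod_continuous_ofLp 2 _ _).snd.comp continuous_subtype_val

/-- The directional derivative `∂_ν w` of `w ∈ H¹(U)`. -/
noncomputable def H1.dirDeriv {n : ℕ} {U : Set (Euc n)} (ν : Euc n) (w : H1 U) :
    Lp ℝ 2 ((volume : Measure (Euc n)).restrict U) :=
  (innerSL ℝ ν).compLpL 2 _ w.grad

lemma H1.continuous_dirDeriv {n : ℕ} {U : Set (Euc n)} (ν : Euc n) :
    Continuous (H1.dirDeriv ν : H1 U → _) :=
  ((innerSL ℝ ν).compLpL 2 _).continuous.comp H1.continuous_grad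

lemma H1.coeFn_dirDeriv {n : ℕ} {U : Set (Euc n)} (ν : Euc n) (w : H1 U) :
    H1.dirDeriv ν w =ᵐ[volume.restrict U] fun x => inner ℝ (w.grad x) ν := by
  filter_upwards [(innerSL ℝ ν).coeFn_compLpL (p := 2) w.grad] with x hx
  rw [real_inner_comm]
  exact hx

lemma H1.norm_dirDeriv_le {n : ℕ} {U : Set (Euc n)} (ν : Euc n) (w : H1 U) :
    ‖H1.dirDeriv ν w‖ ≤ ‖(innerSL ℝ ν).compLpL 2 ((volume : Measure (Euc n)).restrict U)‖ * ‖w‖ :=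
  (ContinuousLinearMap.le_opNorm _ _).trans
    (mul_le_mul_of_nonneg_left w.norm_grad_le (norm_nonneg _))

lemma continuous_mulL1 {α : Type*} {m : MeasurableSpace α} (μ : Measure α) :
    Continuous fun p : Lp ℝ 2 μ × Lp ℝ 2 μ => mulL1 μ p.1 p.2 :=
  (mulL1 μ).isBoundedBilinearMap.continuous

/-- The bilinear expression `∂_ν (χ v w)` on `H¹(U) × H¹(U)`. -/
theorem exists_leibniz {n : ℕ} (U : Set (Euc n)) {χ : Euc n → ℝ} (h : ContDiff ℝ ∞ χ)
    (hc : HasCompactSupport χ) (ν : Euc n) :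
    ∃ B : H1 U → H1 U → Lp ℝ 1 ((volume : Measure (Euc n)).restrict U),
      (Continuous fun p : H1 U × H1 U => B p.1 p.2) ∧
      (∃ K : ℝ, ∀ v w, ‖B v w‖ ≤ K * (‖v‖ * ‖w‖)) ∧
      ∀ v w, B v w =ᵐ[volume.restrict U] fun x => fderiv ℝ χ x ν * (v.fn x * w.fn x) +
        χ x * (inner ℝ (v.grad x) ν * w.fn x + v.fn x * inner ℝ (w.grad x) ν) := by
  set μ := (volume : Measure (Euc n)).restrict U
  obtain ⟨M, hM⟩ := exists_mul_L2 μ h.continuous hc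
  obtain ⟨M', hM'⟩ := exists_mul_L2 μ (χ := fun x => fderiv ℝ χ x ν)
    ((h.continuous_fderiv (by simp)).clm_apply continuous_const) (hc.fderiv_apply (𝕜 := ℝ) ν)
  -- The expression is built as a continuous `L¹`-valued map, so that facts proved for smooth pairs
  -- pass to limits in `H¹(U) × H¹(U)`.
  refine ⟨fun v w => mulL1 μ (M' v.fn) w.fn + (mulL1 μ (M (H1.dirDeriv ν v)) w.fn
        + mulL1 μ (M v.fn) (H1.dirDeriv ν w)), ?_, ?_, fun v w => ?_⟩
  · have c1 : Continuous fun p : H1 U × H1 U => H1.fn p.1 := H1.continuous_fn.comp continuous_fst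
    have c2 : Continuous fun p : H1 U × H1 U => H1.fn p.2 := H1.continuous_fn.comp continuous_snd
    have c3 : Continuous fun p : H1 U × H1 U => H1.dirDeriv ν p.1 :=
      (H1.continuous_dirDeriv ν).comp continuous_fst
    have c4 : Continuous fun p : H1 U × H1 U => H1.dirDeriv ν p.2 :=
      (H1.continuous_dirDeriv ν).comp continuous_snd
    have k1 := (continuous_mulL1 μ).comp ((M'.continuous.comp c1).prodMk c2)
    have k2 := (continuous_mulL1 μ).comp ((M.continuous.comp c3).prodMk c2)
    have k3 := (continuous_mulL1 μ).comp ((M.continuous.comp c1).prodMk c4)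
    exact k1.add (k2.add k3)
  · set d := ‖(innerSL ℝ ν).compLpL 2 μ‖
    refine ⟨‖mulL1 μ‖ * (‖M'‖ + 2 * ‖M‖ * d), fun v w => ?_⟩
    have hd : 0 ≤ d := norm_nonneg _
    have hm : ∀ (N : Lp ℝ 2 μ →L[ℝ] Lp ℝ 2 μ) (f g : Lp ℝ 2 μ) (a b : ℝ), 0 ≤ a →
        ‖f‖ ≤ a → ‖g‖ ≤ b → ‖mulL1 μ (N f) g‖ ≤ ‖mulL1 μ‖ * (‖N‖ * a) * b := by
      intro N f g a b ha hf hg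
      refine ((mulL1 μ).le_opNorm₂ _ _).trans ?_
      have := (N.le_opNorm f).trans (mul_le_mul_of_nonneg_left hf (norm_nonneg N))
      gcongr
    have k1 := hm M' v.fn w.fn _ _ (norm_nonneg _) v.norm_fn_le w.norm_fn_le
    have k2 := hm M (H1.dirDeriv ν v) w.fn _ _ (mul_nonneg hd (norm_nonneg v))
      (v.norm_dirDeriv_le ν) w.norm_fn_le
    have k3 := hm M v.fn (H1.dirDeriv ν w) _ _ (norm_nonneg _) v.norm_fn_le
      (w.norm_dirDeriv_le ν)
    refine ((norm_add_le _ _).trans (add_le_add k1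
      ((norm_add_le _ _).trans (add_le_add k2 k3)))).trans (le_of_eq ?_)
    ring
  filter_upwards [Lp.coeFn_add (mulL1 μ (M' v.fn) w.fn) (mulL1 μ (M (H1.dirDeriv ν v)) w.fn
        + mulL1 μ (M v.fn) (H1.dirDeriv ν w)),
    Lp.coeFn_add (mulL1 μ (M (H1.dirDeriv ν v)) w.fn) (mulL1 μ (M v.fn) (H1.dirDeriv ν w)),
    coeFn_mulL1 μ (M' v.fn) w.fn, coeFn_mulL1 μ (M (H1.dirDeriv ν v)) w.fn,
    coeFn_mulL1 μ (M v.fn) (H1.dirDeriv ν w), hM' v.fn, hM v.fn, hM (H1.dirDeriv ν v),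
    H1.coeFn_dirDeriv ν v, H1.coeFn_dirDeriv ν w] with x e1 e2 e3 e4 e5 e6 e7 e8 e9 e10
  rw [e1, Pi.add_apply, e2, Pi.add_apply, e3, e4, e5, e6, e7, e8, e9, e10]
  ring

lemma fderiv_mul_mul {n : ℕ} {χ φ ψ : Euc n → ℝ} (h1 : ContDiff ℝ ∞ χ) (h2 : ContDiff ℝ ∞ φ)
    (h3 : ContDiff ℝ ∞ ψ) (x ν : Euc n) :
    fderiv ℝ (fun x => χ x * (φ x * ψ x)) x ν = fderiv ℝ χ x ν * (φ x * ψ x) +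
      χ x * (fderiv ℝ φ x ν * ψ x + φ x * fderiv ℝ ψ x ν) := by
  have d1 := h1.differentiable (by simp) x
  have d2 := h2.differentiable (by simp) x
  have d3 := h3.differentiable (by simp) x
  rw [fderiv_fun_mul d1 (d2.fun_mul d3), fderiv_fun_mul d2 d3]
  simp
  ring

/-! ### The trace inequality -/

/-- Finiteness holds in each chart, hence on the compact boundary. It places the boundary values of
smooth functions in `L²(∂Ω)`. -/
theorem isFiniteMeasure_surf_frontier {m : ℕ} {Ω : Set (Euc (m + 1))} (hΩ : IsOpen Ω)
    (hb : Bornology.IsBounded Ω) (hS : HasSmoothBoundary Ω) :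
    IsFiniteMeasure (surf (frontier Ω)) := by
  have hK : IsCompact (frontier Ω) :=
    hb.isCompact_closure.of_isClosed_subset isClosed_frontier frontier_subset_closure
  have h := hK.measure_lt_top_of_nhdsWithin (μ := surf (frontier Ω)) fun x hx => by
    obtain ⟨ν, ρ, C, hρ, -, hfin, -⟩ := exists_local_trace_inequality hΩ hS hx
    exact ⟨_, mem_nhdsWithin_of_mem_nhds (Metric.ball_mem_nhds x hρ), hfin⟩
  refine ⟨?_⟩
  rw [surf, Measure.restrict_apply MeasurableSet.univ, univ_inter]
  rwa [surf, Measure.restrict_apply_self] at h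

theorem exists_mem_smoothTraceGraph {m : ℕ} {Ω : Set (Euc (m + 1))} (hΩ : IsOpen Ω)
    (hb : Bornology.IsBounded Ω) (hS : HasSmoothBoundary Ω) {φ : Euc (m + 1) → ℝ}
    (hφ : ContDiff ℝ ∞ φ) :
    ∃ (w : H1 Ω) (g : Lp ℝ 2 (surf (frontier Ω))), (w, g) ∈ smoothTraceGraph Ω ∧
      w.fn =ᵐ[volume.restrict Ω] φ ∧ w.grad =ᵐ[volume.restrict Ω] gradient φ ∧
      g =ᵐ[surf (frontier Ω)] φ := by
  obtain ⟨w, hw, hw'⟩ := exists_H1_of_contDiff hb hφ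
  have := isFiniteMeasure_surf_frontier hΩ hb hS
  have hK : IsCompact (frontier Ω) :=
    hb.isCompact_closure.of_isClosed_subset isClosed_frontier frontier_subset_closure
  obtain ⟨C, hC⟩ := hK.exists_bound_of_continuousOn hφ.continuous.continuousOn
  have hm : MemLp φ 2 (surf (frontier Ω)) :=
    MemLp.of_bound hφ.continuous.aestronglyMeasurable C
      ((ae_restrict_mem isClosed_frontier.measurableSet).mono hC)
  exact ⟨w, hm.toLp φ, ⟨φ, hφ, hw, hm.coeFn_toLp⟩, hw, hw', hm.coeFn_toLp⟩

/-- Near a boundary point, `∫_∂Ω |χ γ(v) γ(w)| ≤ C ∫_Ω |∂_ν(χ v w)|`. -/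
theorem exists_trace_mul_inequality {m : ℕ} {Ω : Set (Euc (m + 1))} (hΩ : IsOpen Ω)
    (hb : Bornology.IsBounded Ω) (hS : HasSmoothBoundary Ω) {x : Euc (m + 1)}
    (hx : x ∈ frontier Ω) :
    ∃ (ν : Euc (m + 1)) (ρ : ℝ) (C : ℝ≥0∞), 0 < ρ ∧ C ≠ ⊤ ∧
      ∀ χ : Euc (m + 1) → ℝ, ContDiff ℝ ∞ χ → HasCompactSupport χ → tsupport χ ⊆ Metric.ball x ρ →
      ∀ B : H1 Ω → H1 Ω → Lp ℝ 1 ((volume : Measure (Euc (m + 1))).restrict Ω),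
      (Continuous fun p : H1 Ω × H1 Ω => B p.1 p.2) →
      (∀ v w, B v w =ᵐ[volume.restrict Ω] fun x => fderiv ℝ χ x ν * (v.fn x * w.fn x) +
        χ x * (inner ℝ (v.grad x) ν * w.fn x + v.fn x * inner ℝ (w.grad x) ν)) →
      ∀ (v w : H1 Ω) (g h : Lp ℝ 2 (surf (frontier Ω))), HasTrace v g → HasTrace w h →
        ∫⁻ y, ‖χ y * (g y * h y)‖ₑ ∂surf (frontier Ω) ≤ C * ‖B v w‖ₑ := by
  obtain ⟨ν, ρ, C, hρ, hC, -, hineq⟩ := exists_local_trace_inequality hΩ hS hx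
  refine ⟨ν, ρ, C, hρ, hC, fun χ hχ hχc hχs B hBc hB => ?_⟩
  obtain ⟨M, hM⟩ := exists_mul_L2 (surf (frontier Ω)) hχ.continuous hχc
  let X := H1 Ω × Lp ℝ 2 (surf (frontier Ω))
  -- `S` is closed. It contains all pairs of smooth graph points, by the local inequality applied to
  -- `χ * (φ * ψ)`, hence all pairs from the closed trace graph.
  let S : Set (X × X) := {q | ‖mulL1 _ (M q.1.2) q.2.2‖ₑ ≤ C * ‖B q.1.1 q.2.1‖ₑ}
  have hA : ∀ q : X × X, ‖mulL1 _ (M q.1.2) q.2.2‖ₑ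
      = ∫⁻ y, ‖χ y * (q.1.2 y * q.2.2 y)‖ₑ ∂surf (frontier Ω) := by
    intro q
    rw [Lp.enorm_def, eLpNorm_one_eq_lintegral_enorm]
    apply lintegral_congr_ae
    filter_upwards [coeFn_mulL1 _ (M q.1.2) q.2.2, hM q.1.2] with y h1 h2
    rw [h1, h2, mul_assoc]
  have hScl : IsClosed S := by
    apply isClosed_le
    · exact ((continuous_mulL1 _).comp ((M.continuous.comp (continuous_snd.comp continuous_fst)).prodMk
        (continuous_snd.comp continuous_snd))).enorm
    · exact (ENNReal.continuous_const_mul hC).comp (hBc.comp ((continuous_fst.comp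
        continuous_fst).prodMk (continuous_fst.comp continuous_snd))).enorm
  have hsub : (smoothTraceGraph Ω : Set X) ×ˢ (smoothTraceGraph Ω : Set X) ⊆ S := by
    rintro ⟨⟨v, g⟩, ⟨w, h⟩⟩ ⟨⟨φ, hφ, h1, h2⟩, ⟨ψ, hψ, h3, h4⟩⟩
    have e1 := H1.grad_ae_eq hΩ hb hφ h1
    have e2 := H1.grad_ae_eq hΩ hb hψ h3
    change ‖mulL1 _ (M g) h‖ₑ ≤ C * ‖B v w‖ₑ
    rw [hA ((v, g), (w, h)), Lp.enorm_def, eLpNorm_one_eq_lintegral_enorm]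
    have hf : ContDiff ℝ ∞ fun x => χ x * (φ x * ψ x) := hχ.mul (hφ.mul hψ)
    have := hineq _ (hf.of_le (by simp)) (tsupport_mul_subset_left.trans hχs)
    convert this using 1
    · apply lintegral_congr_ae
      filter_upwards [h2, h4] with y k2 k4
      rw [k2, k4]
    · congr 1
      apply lintegral_congr_ae
      filter_upwards [hB v w, h1, h3, e1, e2] with y k1 k2 k3 k4 k5
      rw [k1, k2, k3, k4, k5, inner_gradient, inner_gradient, fderiv_mul_mul hχ hφ hψ]
  intro v w g h hv hw
  have hmem : ((v, g), (w, h)) ∈ closure ((smoothTraceGraph Ω : Set X) ×ˢ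
      (smoothTraceGraph Ω : Set X)) := by
    rw [closure_prod_eq]
    exact ⟨hv, hw⟩
  have := hScl.closure_subset_iff.2 hsub hmem
  rw [← hA ((v, g), (w, h))]
  exact this

/-- The product inequality with `v = w` and a bump equal to `1` near `x` bounds the square of the
trace locally by `‖w‖ ^ 2`; compactness of the boundary makes the bound global. -/
theorem exists_norm_trace_le {m : ℕ} {Ω : Set (Euc (m + 1))} (hΩ : IsOpen Ω)
    (hb : Bornology.IsBounded Ω) (hS : HasSmoothBoundary Ω) :
    ∃ C : ℝ, 0 ≤ C ∧ ∀ (w : H1 Ω) (g : Lp ℝ 2 (surf (frontier Ω))), HasTrace w g →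
      ‖g‖ ≤ C * ‖w‖ := by
  have hK : IsCompact (frontier Ω) :=
    hb.isCompact_closure.of_isClosed_subset isClosed_frontier frontier_subset_closure
  have key : ∃ C : ℝ≥0∞, C ≠ ⊤ ∧ ∀ (w : H1 Ω) (g : Lp ℝ 2 (surf (frontier Ω))), HasTrace w g →
      ∫⁻ y in frontier Ω, ‖g y‖ₑ ^ 2 ∂surf (frontier Ω) ≤ C * ‖w‖ₑ ^ 2 := by
    refine hK.induction_on (p := fun s => ∃ C : ℝ≥0∞, C ≠ ⊤ ∧
      ∀ (w : H1 Ω) (g : Lp ℝ 2 (surf (frontier Ω))), HasTrace w g →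
      ∫⁻ y in s, ‖g y‖ₑ ^ 2 ∂surf (frontier Ω) ≤ C * ‖w‖ₑ ^ 2) ⟨0, by simp, by simp⟩ ?_ ?_ ?_
    · rintro s t hst ⟨C, hC, h⟩
      exact ⟨C, hC, fun w g hw => (lintegral_mono_set hst).trans (h w g hw)⟩
    · rintro s t ⟨C, hC, h⟩ ⟨C', hC', h'⟩
      refine ⟨C + C', ENNReal.add_ne_top.2 ⟨hC, hC'⟩, fun w g hw => ?_⟩
      rw [add_mul]
      exact (lintegral_union_le _ s t).trans (add_le_add (h w g hw) (h' w g hw))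
    · intro x hx
      obtain ⟨ν, ρ, C, hρ, hC, hineq⟩ := exists_trace_mul_inequality hΩ hb hS hx
      let b : ContDiffBump x := ⟨ρ / 3, ρ / 2, by positivity, by linarith⟩
      obtain ⟨B, hBc, ⟨K, hBK⟩, hB⟩ := exists_leibniz Ω b.contDiff b.hasCompactSupport ν
      have hbs : tsupport b ⊆ Metric.ball x ρ := by
        rw [b.tsupport_eq]
        exact Metric.closedBall_subset_ball (by change ρ / 2 < ρ; linarith)
      have := hineq b b.contDiff b.hasCompactSupport hbs B hBc hB
      refine ⟨Metric.ball x (ρ / 3), mem_nhdsWithin_of_mem_nhds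
        (Metric.ball_mem_nhds x (by positivity)), C * ENNReal.ofReal K, ENNReal.mul_ne_top hC (by simp), ?_⟩
      intro w g hw
      calc ∫⁻ y in Metric.ball x (ρ / 3), ‖g y‖ₑ ^ 2 ∂surf (frontier Ω)
          = ∫⁻ y in Metric.ball x (ρ / 3), ‖b y * (g y * g y)‖ₑ ∂surf (frontier Ω) := by
            apply setLIntegral_congr_fun measurableSet_ball
            intro y hy
            simp only
            rw [b.one_of_mem_closedBall (Metric.ball_subset_closedBall hy), one_mul, enorm_mul, sq]
        _ ≤ ∫⁻ y, ‖b y * (g y * g y)‖ₑ ∂surf (frontier Ω) := setLIntegral_le_lintegral _ _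
        _ ≤ C * ‖B w w‖ₑ := this w w g g hw hw
        _ ≤ C * (ENNReal.ofReal K * (‖w‖ₑ * ‖w‖ₑ)) := by
            refine mul_le_mul_right ?_ C
            rw [← ofReal_norm, ← ofReal_norm w, ← ENNReal.ofReal_mul (norm_nonneg _),
              ← ENNReal.ofReal_mul' (by positivity)]
            exact ENNReal.ofReal_le_ofReal (hBK w w)
        _ = C * ENNReal.ofReal K * ‖w‖ₑ ^ 2 := by ring
  obtain ⟨C, hC, h⟩ := key
  refine ⟨Real.sqrt C.toReal, Real.sqrt_nonneg _, fun w g hw => ?_⟩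
  have h1 := h w g hw
  have h2 : ∫⁻ y in frontier Ω, ‖g y‖ₑ ^ 2 ∂surf (frontier Ω) = ‖g‖ₑ ^ 2 := by
    have : (surf (frontier Ω)).restrict (frontier Ω) = surf (frontier Ω) :=
      Measure.restrict_restrict_of_subset Subset.rfl
    rw [this, Lp.enorm_def, eLpNorm_eq_lintegral_rpow_enorm_toReal (by simp) (by simp)]
    rw [← ENNReal.rpow_natCast, ← ENNReal.rpow_mul]
    simp
  rw [h2, ← ofReal_norm, ← ofReal_norm w, ← ENNReal.ofReal_toReal hC,
    ← ENNReal.ofReal_pow (norm_nonneg _), ← ENNReal.ofReal_pow (norm_nonneg _),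
    ← ENNReal.ofReal_mul ENNReal.toReal_nonneg, ENNReal.ofReal_le_ofReal_iff (by positivity)] at h1
  rw [← Real.sqrt_sq (norm_nonneg g), ← Real.sqrt_sq (norm_nonneg w), ← Real.sqrt_mul (by simp)]
  exact Real.sqrt_le_sqrt h1


/-! ### Mollification in `L²(ℝⁿ)` -/

lemma tendsto_eLpNorm_translate_sub {n : ℕ} {F : Type*} [NormedAddCommGroup F] {h : Euc n → F}
    (hh : MemLp h 2 (volume : Measure (Euc n))) :
    Tendsto (fun z => eLpNorm (fun y => h (y - z) - h y) 2 (volume : Measure (Euc n)))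
      (𝓝 0) (𝓝 0) := by
  let g : C(Euc n, C(Euc n, Euc n)) :=
    ContinuousMap.curry ⟨fun p : Euc n × Euc n => p.2 - p.1, by fun_prop⟩
  have hg : ∀ z, MeasurePreserving (g z) (volume : Measure (Euc n)) volume := fun z =>
    measurePreserving_sub_right volume z
  have h1 := (tendsto_const_nhds (x := hh.toLp h) (f := 𝓝 (0 : Euc n))).compMeasurePreservingLp
    (g.continuous.tendsto 0) hg (hg 0) (by simp)
  rw [tendsto_iff_edist_tendsto_0] at h1
  refine h1.congr fun z => ?_
  rw [Lp.toLp_compMeasurePreserving, Lp.toLp_compMeasurePreserving, Lp.edist_toLp_toLp]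
  apply eLpNorm_congr_ae
  refine Eventually.of_forall fun y => ?_
  change h (y - z) - h (y - 0) = _
  rw [sub_zero]

/-- `k` is regarded as a probability density: the comparison of `L¹` with `L²` norms for a
probability measure bounds the squared error pointwise, and Tonelli integrates it. Only translations
by points of `tsupport k` matter, so `k` need not be centred at `0`. -/
lemma eLpNorm_conv_sub_le {n : ℕ} {F : Type*} [NormedAddCommGroup F] [NormedSpace ℝ F]
    [CompleteSpace F] {h : Euc n → F} (hm : StronglyMeasurable h)
    (hh : MemLp h 2 (volume : Measure (Euc n))) {k : Euc n → ℝ} (hk : Continuous k)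
    (hc : HasCompactSupport k) (h0 : ∀ z, 0 ≤ k z) (h1 : ∫ z, k z = 1) {ε : ℝ≥0∞}
    (hε : ∀ z ∈ tsupport k,
      eLpNorm (fun y => h (y - z) - h y) 2 (volume : Measure (Euc n)) ≤ ε) :
    eLpNorm (fun y => (∫ z, k z • h (y - z)) - h y) 2 (volume : Measure (Euc n)) ≤ ε := by
  set K : Euc n → ℝ≥0∞ := fun z => ENNReal.ofReal (k z) with hK
  have hKm : Measurable K := hk.measurable.ennreal_ofReal
  have hki : Integrable k := hk.integrable_of_hasCompactSupport hc
  have hK1 : ∫⁻ z, K z = 1 := by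
    rw [← ofReal_integral_eq_lintegral_ofReal hki (Eventually.of_forall h0), h1]
    simp
  let κ : Measure (Euc n) := volume.withDensity K
  have hκ : IsProbabilityMeasure κ := ⟨by
    rw [withDensity_apply _ MeasurableSet.univ, Measure.restrict_univ, hK1]⟩
  have hD : StronglyMeasurable fun p : Euc n × Euc n => h (p.1 - p.2) - h p.1 :=
    (hm.comp_measurable (by fun_prop)).sub (hm.comp_measurable measurable_fst)
  have hDm : Measurable fun p : Euc n × Euc n => ‖h (p.1 - p.2) - h p.1‖ₑ := hD.enorm
  have hloc : LocallyIntegrable h := hh.locallyIntegrable (by norm_num)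
  have point : ∀ y, ‖(∫ z, k z • h (y - z)) - h y‖ₑ ^ 2
      ≤ ∫⁻ z, K z * ‖h (y - z) - h y‖ₑ ^ 2 := by
    intro y
    have i1 : Integrable fun z => k z • h (y - z) :=
      (hc.convolutionExists_left (ContinuousLinearMap.lsmul ℝ ℝ) hk hloc y).integrable
    have i2 : Integrable fun z => k z • h y := hki.smul_const _
    have e1 : (∫ z, k z • h (y - z)) - h y = ∫ z, k z • (h (y - z) - h y) := by
      simp_rw [smul_sub]
      rw [integral_sub i1 i2, integral_smul_const, h1, one_smul]
    have hDy : StronglyMeasurable fun z => h (y - z) - h y :=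
      hD.comp_measurable measurable_prodMk_left
    have e2 : ‖(∫ z, k z • h (y - z)) - h y‖ₑ ≤ eLpNorm (fun z => h (y - z) - h y) 1 κ := by
      rw [e1, eLpNorm_one_eq_lintegral_enorm, lintegral_withDensity_eq_lintegral_mul _ hKm
        hDy.enorm]
      refine (enorm_integral_le_lintegral_enorm _).trans (le_of_eq ?_)
      refine lintegral_congr fun z => ?_
      rw [enorm_smul, Real.enorm_of_nonneg (h0 z)]
      rfl
    have e3 : eLpNorm (fun z => h (y - z) - h y) 1 κ ≤ eLpNorm (fun z => h (y - z) - h y) 2 κ :=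
      eLpNorm_le_eLpNorm_of_exponent_le (by norm_num) hDy.aestronglyMeasurable
    calc _ ≤ (eLpNorm (fun z => h (y - z) - h y) 2 κ) ^ 2 := by gcongr; exact e2.trans e3
      _ = ∫⁻ z, ‖h (y - z) - h y‖ₑ ^ 2 ∂κ := by
        rw [eLpNorm_eq_lintegral_rpow_enorm_toReal (by simp) (by simp), ← ENNReal.rpow_natCast,
          ← ENNReal.rpow_mul]
        simp
      _ = _ := by
        rw [lintegral_withDensity_eq_lintegral_mul _ hKm (hDy.enorm.pow_const 2)]
        rfl
  have hsq : ∀ u : Euc n → F, eLpNorm u 2 (volume : Measure (Euc n)) ≤ ε ↔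
      ∫⁻ y, ‖u y‖ₑ ^ 2 ≤ ε ^ 2 := by
    intro u
    rw [eLpNorm_eq_lintegral_rpow_enorm_toReal (by simp) (by simp)]
    simp only [ENNReal.toReal_ofNat, ENNReal.rpow_ofNat]
    rw [← ENNReal.rpow_le_rpow_iff (z := 2) (by norm_num), ← ENNReal.rpow_mul]
    simp
  rw [hsq]
  calc ∫⁻ y, ‖(∫ z, k z • h (y - z)) - h y‖ₑ ^ 2
      ≤ ∫⁻ y, ∫⁻ z, K z * ‖h (y - z) - h y‖ₑ ^ 2 := lintegral_mono point
    _ = ∫⁻ z, ∫⁻ y, K z * ‖h (y - z) - h y‖ₑ ^ 2 :=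
        lintegral_lintegral_swap
          ((hKm.comp measurable_snd).mul (hDm.pow_const 2)).aemeasurable
    _ = ∫⁻ z, K z * ∫⁻ y, ‖h (y - z) - h y‖ₑ ^ 2 := by
        refine lintegral_congr fun z => ?_
        rw [lintegral_const_mul]
        exact (hDm.comp measurable_prodMk_right).pow_const 2
    _ ≤ ∫⁻ z, K z * ε ^ 2 := by
        refine lintegral_mono fun z => ?_
        by_cases hz : z ∈ tsupport k
        · exact mul_le_mul_right ((hsq _).1 (hε z hz)) _
        · simp [hK, image_eq_zero_of_notMem_tsupport hz]
    _ = ε ^ 2 := by rw [lintegral_mul_const _ hKm, hK1, one_mul]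

/-! ### Approximation kernels -/

/-- A smooth probability density supported in the `δ`-ball, all of whose translates that reach `N`
from a point of `Ω` stay inside `Ω`. -/
structure IsKernel {n : ℕ} (Ω N : Set (Euc n)) (δ : ℝ) (k : Euc n → ℝ) : Prop where
  contDiff : ContDiff ℝ ∞ k
  hasCompactSupport : HasCompactSupport k
  nonneg : ∀ z, 0 ≤ k z
  integral_eq : ∫ z, k z = 1
  tsupport_subset : tsupport k ⊆ Metric.ball 0 δ
  sub_mem : ∀ y ∈ Ω, (∃ z ∈ tsupport k, y - z ∈ N) → ∀ z ∈ tsupport k, y - z ∈ Ω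

lemma isKernel_normed {n : ℕ} {Ω N : Set (Euc n)} {δ : ℝ} {c : Euc n} (b : ContDiffBump c)
    (h1 : Metric.closedBall c b.rOut ⊆ Metric.ball 0 δ)
    (h2 : ∀ y ∈ Ω, (∃ z ∈ Metric.closedBall c b.rOut, y - z ∈ N) →
      ∀ z ∈ Metric.closedBall c b.rOut, y - z ∈ Ω) :
    IsKernel Ω N δ (b.normed volume) where
  contDiff := b.contDiff_normed
  hasCompactSupport := b.hasCompactSupport_normed
  nonneg := b.nonneg_normed
  integral_eq := b.integral_normed
  tsupport_subset := by rwa [b.tsupport_normed_eq]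
  sub_mem := by rwa [b.tsupport_normed_eq]

lemma exists_isKernel_of_mem {n : ℕ} {Ω : Set (Euc n)} (hΩ : IsOpen Ω) {x : Euc n} (hx : x ∈ Ω) :
    ∃ ρ > 0, ∀ δ > 0, ∃ k, IsKernel Ω (Metric.ball x ρ) δ k := by
  obtain ⟨ρ, hρ, hball⟩ := Metric.isOpen_iff.1 hΩ x hx
  refine ⟨ρ / 2, by positivity, fun δ hδ => ?_⟩
  -- Two points of the kernel's support differ by at most `ρ / 4`, so `y - z'` stays within `ρ / 2 +
  -- ρ / 4 < ρ` of `x`.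
  have hm : 0 < min (δ / 2) (ρ / 8) := by positivity
  let b : ContDiffBump (0 : Euc n) := ⟨min (δ / 2) (ρ / 8) / 2, min (δ / 2) (ρ / 8), by positivity,
    by linarith⟩
  have hb1 : b.rOut ≤ δ / 2 := min_le_left _ _
  have hb2 : b.rOut ≤ ρ / 8 := min_le_right _ _
  refine ⟨_, isKernel_normed b (Metric.closedBall_subset_ball (by linarith)) ?_⟩
  rintro y - ⟨z, hz, hyz⟩ z' hz'
  apply hball
  rw [mem_closedBall_zero_iff] at hz hz'
  rw [Metric.mem_ball, dist_eq_norm] at hyz ⊢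
  have e : y - z' - x = (y - z - x) + (z - z') := by abel
  rw [e]
  have h1 := norm_add_le (y - z - x) (z - z')
  have h2 := norm_sub_le z z'
  linarith

/-- The kernel is centred at `-(t • ν)`, so the convolution at `y` samples near `y + t • ν`, pushed
into `Ω`. The support is so small compared with `t` that no sample falls back across the graph. -/
lemma exists_isKernel_of_mem_frontier {n : ℕ} {Ω : Set (Euc n)} (hS : HasSmoothBoundary Ω)
    {x : Euc n} (hx : x ∈ frontier Ω) :
    ∃ ρ > 0, ∀ δ > 0, ∃ k, IsKernel Ω (Metric.ball x ρ) δ k := by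
  obtain ⟨ν, γ, ρ, hν, hγ, hγν, hρ, hball⟩ := hS x hx
  obtain ⟨L, hL⟩ := (hγ.of_le (n := ∞) (m := 1) (by simp)).locallyLipschitz.locallyLipschitzOn
    (s := Metric.closedBall x ρ) |>.exists_lipschitzOnWith_of_compact (isCompact_closedBall x ρ)
  refine ⟨ρ / 2, by positivity, fun δ hδ => ?_⟩
  set t := min (δ / 4) (ρ / 16) with ht
  have ht0 : 0 < t := by positivity
  have ht1 : t ≤ δ / 4 := min_le_left _ _
  have ht2 : t ≤ ρ / 16 := min_le_right _ _
  -- A deviation of size `ε` raises the graph by at most `L * ε` and lowers the height by at most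
  -- `ε`; together these are `t / 2`, less than the push `t`.
  set ε := t / (2 * (1 + (L : ℝ))) with hε
  have hL0 : 0 ≤ (L : ℝ) := L.2
  have hε0 : 0 < ε := by positivity
  have hεt : 2 * (ε * (1 + L)) = t := by rw [hε]; field_simp
  have hεt' : ε ≤ t := by nlinarith
  let b : ContDiffBump (-(t • ν)) := ⟨ε / 2, ε, by positivity, by linarith⟩
  have hz : ∀ z ∈ Metric.closedBall (-(t • ν)) b.rOut, ‖z + t • ν‖ ≤ ε ∧ ‖z‖ ≤ 2 * t := by
    intro z hz
    rw [mem_closedBall_iff_norm, sub_neg_eq_add] at hz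
    have hz' : ‖z + t • ν‖ ≤ ε := hz
    refine ⟨hz', ?_⟩
    have h1 : ‖t • ν‖ = t := by rw [norm_smul, hν, mul_one, Real.norm_of_nonneg ht0.le]
    have h2 := norm_sub_le (z + t • ν) (t • ν)
    rw [add_sub_cancel_right] at h2
    linarith
  refine ⟨_, isKernel_normed b ?_ ?_⟩
  · intro z hz'
    rw [mem_ball_zero_iff]
    linarith [(hz z hz').2]
  · rintro y hy ⟨z, hz1, hyz⟩ z' hz1'
    obtain ⟨-, hzn⟩ := hz z hz1
    obtain ⟨hze', hzn'⟩ := hz z' hz1'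
    rw [Metric.mem_ball, dist_eq_norm] at hyz
    have by1 : ‖y - x‖ ≤ ρ / 2 + 2 * t := by
      have e : y - x = (y - z - x) + z := by abel
      rw [e]
      linarith [norm_add_le (y - z - x) z]
    have hyb : y ∈ Metric.ball x ρ := by
      rw [Metric.mem_ball, dist_eq_norm]; linarith
    have hyΩ : y ∈ {y | y ∈ Metric.ball x ρ ∧ γ y < inner ℝ y ν} := hball ▸ ⟨hy, hyb⟩
    set e := -(z' + t • ν) with he
    have hen : ‖e‖ ≤ ε := by rw [he, norm_neg]; exact hze'
    have hp : y - z' = (y + e) + t • ν := by rw [he]; abel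
    have hye : y + e ∈ Metric.closedBall x ρ := by
      rw [mem_closedBall_iff_norm]
      have e' : y + e - x = (y - x) + e := by abel
      rw [e']
      linarith [norm_add_le (y - x) e]
    have hpb : y - z' ∈ Metric.ball x ρ := by
      rw [Metric.mem_ball, dist_eq_norm]
      have e' : y - z' - x = (y - x) - z' := by abel
      rw [e']
      linarith [norm_sub_le (y - x) z']
    have hγe : γ (y + e) ≤ γ y + L * ε := by
      have := hL.dist_le_mul _ hye _ (Metric.ball_subset_closedBall hyb)
      rw [Real.dist_eq, dist_eq_norm, add_sub_cancel_left] at this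
      have h2 := le_abs_self (γ (y + e) - γ y)
      have h3 : (L : ℝ) * ‖e‖ ≤ L * ε := mul_le_mul_of_nonneg_left hen hL0
      linarith
    have hin : inner ℝ (y - z') ν = inner ℝ y ν + inner ℝ e ν + t := by
      rw [hp, inner_add_left, inner_add_left, real_inner_smul_left, real_inner_self_eq_norm_sq, hν]
      ring
    have hie : -ε ≤ inner ℝ e ν := by
      have := abs_real_inner_le_norm e ν
      rw [hν, mul_one] at this
      linarith [neg_abs_le (inner ℝ e ν)]
    have : y - z' ∈ {y | y ∈ Metric.ball x ρ ∧ γ y < inner ℝ y ν} := by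
      refine ⟨hpb, ?_⟩
      rw [hin, hp, hγν]
      nlinarith [hyΩ.2]
    rw [← hball] at this
    exact this.1

lemma exists_isKernel {n : ℕ} {Ω : Set (Euc n)} (hΩ : IsOpen Ω) (hS : HasSmoothBoundary Ω)
    {x : Euc n} (hx : x ∈ closure Ω) :
    ∃ ρ > 0, ∀ δ > 0, ∃ k, IsKernel Ω (Metric.ball x ρ) δ k := by
  by_cases h : x ∈ Ω
  · exact exists_isKernel_of_mem hΩ h
  · exact exists_isKernel_of_mem_frontier hS (hΩ.frontier_eq ▸ ⟨hx, h⟩)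


/-! ### Density of smooth functions in `H¹(Ω)` -/

lemma H1.ext_fn {n : ℕ} {U : Set (Euc n)} (hU : IsOpen U) {v w : H1 U}
    (h : v.fn =ᵐ[volume.restrict U] w.fn) : v = w :=
  H1.ext' h (IsWeakGradient.ae_eq hU (Lp.memLp _) (Lp.memLp _) v.isWeakGradient
    (w.isWeakGradient.congr h.symm .rfl))

/-- The elements of `H¹(Ω)` that are restrictions of smooth functions on `ℝⁿ`. -/
def smoothH1 {n : ℕ} (Ω : Set (Euc n)) : Submodule ℝ (H1 Ω) where
  carrier := {w | ∃ φ : Euc n → ℝ, ContDiff ℝ ∞ φ ∧ w.fn =ᵐ[volume.restrict Ω] φ}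
  add_mem' := by
    rintro a b ⟨φ, h1, h2⟩ ⟨ψ, k1, k2⟩
    exact ⟨φ + ψ, h1.add k1, (H1.coeFn_fn_add a b).trans (h2.add k2)⟩
  zero_mem' := ⟨0, contDiff_const, Lp.coeFn_zero _ _ _⟩
  smul_mem' := by
    rintro c a ⟨φ, h1, h2⟩
    exact ⟨c • φ, contDiff_const.smul h1, (H1.coeFn_fn_smul c a).trans (h2.const_smul c)⟩

lemma integral_kernel_smul_eq_zero {n : ℕ} {F : Type*} [NormedAddCommGroup F] [NormedSpace ℝ F]
    {k : Euc n → ℝ} {h : Euc n → F} {y : Euc n} (hh : ∀ z ∈ tsupport k, h (y - z) = 0) :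
    ∫ z, k z • h (y - z) = 0 := by
  rw [← integral_zero (Euc n) F (μ := volume)]
  congr 1 with z
  by_cases hz : z ∈ tsupport k
  · rw [hh z hz, smul_zero]
  · rw [image_eq_zero_of_notMem_tsupport hz, zero_smul]

lemma fderiv_kernel_conv {n : ℕ} {k : Euc n → ℝ} (hk : ContDiff ℝ ∞ k) (hc : HasCompactSupport k)
    {u : Euc n → ℝ} (hu : LocallyIntegrable u) (y v : Euc n) :
    fderiv ℝ (fun y => ∫ z, k z • u (y - z)) y v = ∫ z, fderiv ℝ k z v • u (y - z) := by
  have h := hc.hasFDerivAt_convolution_left (ContinuousLinearMap.lsmul ℝ ℝ)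
    (hk.of_le (by simp)) hu y
  have h' : HasFDerivAt (fun y => ∫ z, k z • u (y - z)) _ y := h
  have hi : ConvolutionExistsAt (fderiv ℝ k) u y
      ((ContinuousLinearMap.lsmul ℝ ℝ : ℝ →L[ℝ] ℝ →L[ℝ] ℝ).precompL (Euc n)) volume :=
    HasCompactSupport.convolutionExists_left _ (hc.fderiv (𝕜 := ℝ))
      (hk.continuous_fderiv (by simp)) hu y
  rw [h'.fderiv, convolution_def, ContinuousLinearMap.integral_apply hi.integrable]
  rfl

/-- On `Ω`, the gradient of the mollification of an extension by zero is the mollification of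
the extension by zero of the weak gradient. -/
lemma gradient_kernel_conv {n : ℕ} {Ω N : Set (Euc n)} (hΩ : IsOpen Ω) {δ : ℝ} {k : Euc n → ℝ}
    (hk : IsKernel Ω N δ k) {u : Euc n → ℝ} {g : Euc n → Euc n}
    (hu : MemLp u 2 (volume.restrict Ω)) (hg : MemLp g 2 (volume.restrict Ω))
    (hug : IsWeakGradient Ω u g) (huN : ∀ y, y ∉ N → u y = 0) (hgN : ∀ y, y ∉ N → g y = 0)
    {y : Euc n} (hy : y ∈ Ω) :
    gradient (fun y => ∫ z, k z • Ω.indicator u (y - z)) y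
      = ∫ z, k z • Ω.indicator g (y - z) := by
  have hu' : MemLp (Ω.indicator u) 2 volume := (memLp_indicator_iff_restrict hΩ.measurableSet).2 hu
  have hg' : MemLp (Ω.indicator g) 2 volume := (memLp_indicator_iff_restrict hΩ.measurableSet).2 hg
  have hloc : LocallyIntegrable (Ω.indicator u) := hu'.locallyIntegrable (by norm_num)
  have hloc' : LocallyIntegrable (Ω.indicator g) := hg'.locallyIntegrable (by norm_num)
  refine ext_inner_right ℝ fun v => ?_
  rw [inner_gradient, fderiv_kernel_conv hk.contDiff hk.hasCompactSupport hloc]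
  -- Extension by zero is in general not weakly differentiable across the boundary. If a translate
  -- reaches `N`, then `sub_mem` keeps `x ↦ k (y - x)` supported in `Ω`, so it is a test function
  -- there; otherwise both sides vanish.
  by_cases hex : ∃ z ∈ tsupport k, y - z ∈ N
  · set φ : Euc n → ℝ := fun x => k (y - x) with hφ
    have hφs : ContDiff ℝ ∞ φ := hk.contDiff.comp (contDiff_const.sub contDiff_id)
    have hφc : HasCompactSupport φ :=
      hk.hasCompactSupport.comp_homeomorph (Homeomorph.subLeft y)
    have hφt : tsupport φ ⊆ Ω := by
      intro x hx
      have : y - x ∈ tsupport k := by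
        have := tsupport_comp_eq_preimage k (Homeomorph.subLeft y)
        have hx' : x ∈ tsupport (k ∘ Homeomorph.subLeft y) := hx
        rw [this] at hx'
        exact hx'
      have h := hk.sub_mem y hy hex _ this
      rwa [sub_sub_cancel] at h
    have hfd : ∀ x, fderiv ℝ φ x v = - fderiv ℝ k (y - x) v := by
      intro x
      have h1 : HasFDerivAt (fun x : Euc n => y - x) (-ContinuousLinearMap.id ℝ (Euc n)) x :=
        (hasFDerivAt_id x).const_sub y
      have h2 := (hk.contDiff.differentiable (by simp) (y - x)).hasFDerivAt.comp x h1
      have h3 : HasFDerivAt φ _ x := h2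
      rw [h3.fderiv]
      simp
    have key := hug φ hφs hφc hφt v
    have e1 : ∫ z, fderiv ℝ k z v • Ω.indicator u (y - z) = - ∫ x in Ω, u x * fderiv ℝ φ x v := by
      rw [← integral_sub_left_eq_self _ volume y, ← integral_neg,
        ← integral_indicator hΩ.measurableSet]
      congr 1 with x
      by_cases hx : x ∈ Ω
      · simp [hx, hfd, mul_comm]
      · simp [hx]
    have hi : Integrable fun z => k z • Ω.indicator g (y - z) :=
      (hk.hasCompactSupport.convolutionExists_left (ContinuousLinearMap.lsmul ℝ ℝ)
        hk.contDiff.continuous hloc' y).integrable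
    rw [e1, key, neg_neg, real_inner_comm, ← integral_inner hi,
      ← integral_sub_left_eq_self (fun z => inner ℝ v (k z • Ω.indicator g (y - z))) volume y,
      ← integral_indicator hΩ.measurableSet]
    congr 1 with x
    by_cases hx : x ∈ Ω
    · simp only [hx, indicator_of_mem, sub_sub_cancel, inner_smul_right, hφ, real_inner_comm v]
      ring
    · simp [hx]
  · push Not at hex
    have e0 : ∫ z, k z • Ω.indicator g (y - z) = 0 := integral_kernel_smul_eq_zero fun z hz => by
      by_cases h : y - z ∈ Ω <;> simp [h, hgN _ (hex z hz)]
    rw [e0, inner_zero_left]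
    exact integral_kernel_smul_eq_zero fun z hz => by
      have hz' : z ∈ tsupport k := tsupport_fderiv_apply_subset ℝ v hz
      by_cases h : y - z ∈ Ω <;> simp [h, huN _ (hex z hz')]

lemma norm_sub_le_of_kernel {n : ℕ} {Ω N : Set (Euc n)} (hΩ : IsOpen Ω) {δ : ℝ} {k : Euc n → ℝ}
    (hk : IsKernel Ω N δ k) {F : Type*} [NormedAddCommGroup F] [NormedSpace ℝ F]
    [CompleteSpace F] {f : Euc n → F} (hfm : StronglyMeasurable f)
    (hf : MemLp f 2 (volume.restrict Ω)) {ε : ℝ} (hε0 : 0 ≤ ε)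
    (hε : ∀ z ∈ Metric.ball (0 : Euc n) δ, eLpNorm (fun y => Ω.indicator f (y - z) -
      Ω.indicator f y) 2 volume ≤ ENNReal.ofReal ε)
    {p q : Lp F 2 ((volume : Measure (Euc n)).restrict Ω)}
    (hp : p =ᵐ[volume.restrict Ω] fun y => ∫ z, k z • Ω.indicator f (y - z))
    (hq : q =ᵐ[volume.restrict Ω] f) : ‖p - q‖ ≤ ε := by
  have h := eLpNorm_conv_sub_le (hfm.indicator hΩ.measurableSet)
    ((memLp_indicator_iff_restrict hΩ.measurableSet).2 hf) hk.contDiff.continuous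
    hk.hasCompactSupport hk.nonneg hk.integral_eq fun z hz => hε z (hk.tsupport_subset hz)
  rw [Lp.norm_def]
  apply ENNReal.toReal_le_of_le_ofReal hε0
  refine le_trans ?_ ((eLpNorm_mono_measure _ (Measure.restrict_le_self (s := Ω))).trans h)
  refine (eLpNorm_congr_ae ?_).le
  filter_upwards [Lp.coeFn_sub p q, hp, hq, ae_restrict_mem hΩ.measurableSet] with y h1 h2 h3 h4
  rw [h1, Pi.sub_apply, h2, h3, indicator_of_mem h4]

/-- `u` and `g` are functions rather than classes because they must vanish everywhere off `N` for
the gradient of the mollification to be computed at every point of `Ω`. -/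
lemma mem_closure_smoothH1_of_kernel {n : ℕ} {Ω N : Set (Euc n)} (hΩ : IsOpen Ω)
    (hb : Bornology.IsBounded Ω) (hN : ∀ δ > 0, ∃ k, IsKernel Ω N δ k) {u : Euc n → ℝ}
    {g : Euc n → Euc n} (hum : StronglyMeasurable u) (hgm : StronglyMeasurable g)
    (hu : MemLp u 2 (volume.restrict Ω)) (hg : MemLp g 2 (volume.restrict Ω))
    (hug : IsWeakGradient Ω u g) (huN : ∀ y, y ∉ N → u y = 0) (hgN : ∀ y, y ∉ N → g y = 0)
    {w : H1 Ω} (hw1 : w.fn =ᵐ[volume.restrict Ω] u) (hw2 : w.grad =ᵐ[volume.restrict Ω] g) :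
    w ∈ closure (smoothH1 Ω : Set (H1 Ω)) := by
  rw [Metric.mem_closure_iff]
  intro ε hε
  have hu' : MemLp (Ω.indicator u) 2 volume := (memLp_indicator_iff_restrict hΩ.measurableSet).2 hu
  have hg' : MemLp (Ω.indicator g) 2 volume := (memLp_indicator_iff_restrict hΩ.measurableSet).2 hg
  have hε3 : (0 : ℝ≥0∞) < ENNReal.ofReal (ε / 3) := ENNReal.ofReal_pos.2 (by positivity)
  have ev := ((tendsto_eLpNorm_translate_sub hu').eventually (ge_mem_nhds hε3)).and
    ((tendsto_eLpNorm_translate_sub hg').eventually (ge_mem_nhds hε3))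
  obtain ⟨δ, hδ, hball⟩ := Metric.eventually_nhds_iff_ball.1 ev
  obtain ⟨k, hk⟩ := hN δ hδ
  have hloc : LocallyIntegrable (Ω.indicator u) := hu'.locallyIntegrable (by norm_num)
  have hfs : ContDiff ℝ ∞ fun y => ∫ z, k z • Ω.indicator u (y - z) :=
    hk.hasCompactSupport.contDiff_convolution_left (ContinuousLinearMap.lsmul ℝ ℝ) hk.contDiff hloc
  obtain ⟨w', h1, h2⟩ := exists_H1_of_contDiff hb hfs
  have h2' : w'.grad =ᵐ[volume.restrict Ω] fun y => ∫ z, k z • Ω.indicator g (y - z) := by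
    filter_upwards [h2, ae_restrict_mem hΩ.measurableSet] with y hy hyΩ
    rw [hy, gradient_kernel_conv hΩ hk hu hg hug huN hgN hyΩ]
  refine ⟨w', ⟨_, hfs, h1⟩, ?_⟩
  have n1 : ‖w'.fn - w.fn‖ ≤ ε / 3 := norm_sub_le_of_kernel hΩ hk hum hu (by positivity)
    (fun z hz => (hball z hz).1) h1 hw1
  have n2 : ‖w'.grad - w.grad‖ ≤ ε / 3 := norm_sub_le_of_kernel hΩ hk hgm hg (by positivity)
    (fun z hz => (hball z hz).2) h2' hw2
  rw [dist_comm, dist_eq_norm]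
  have n3 : ‖w' - w‖ ≤ ‖w'.fn - w.fn‖ + ‖w'.grad - w.grad‖ := (w' - w).norm_le_add
  linarith

lemma exists_finite_smooth_partition {n : ℕ} {K : Set (Euc n)} (hK : IsCompact K)
    {U : Euc n → Set (Euc n)} (hU : ∀ x ∈ K, IsOpen (U x) ∧ x ∈ U x) :
    ∃ (t : Finset (Euc n)) (χ : t → Euc n → ℝ), (∀ i : t, (i : Euc n) ∈ K) ∧
      (∀ i, ContDiff ℝ ∞ (χ i)) ∧ (∀ i, tsupport (χ i) ⊆ U i) ∧
      ∀ x ∈ K, ∑ i, χ i x = 1 := by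
  obtain ⟨t, htK, ht⟩ := hK.elim_nhds_subcover U fun x hx => (hU x hx).1.mem_nhds (hU x hx).2
  obtain ⟨f, hf⟩ := SmoothPartitionOfUnity.exists_isSubordinate (I := modelWithCornersSelf ℝ (Euc n))
    hK.isClosed (fun i : t => U i) (fun i => (hU i (htK i i.2)).1) (by
      intro x hx
      obtain ⟨i, hi, hxi⟩ := mem_iUnion₂.1 (ht hx)
      exact mem_iUnion.2 ⟨⟨i, hi⟩, hxi⟩)
  refine ⟨t, fun i => f i, fun i => htK i i.2, fun i => (f i).contMDiff.contDiff, hf, fun x hx => ?_⟩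
  rw [← finsum_eq_sum_of_fintype]
  exact f.sum_eq_one hx

/-- A partition of unity on the closure of `Ω` splits `w` into pieces, each supported where a single
family of shifted kernels works. -/
theorem closure_smoothH1 {n : ℕ} {Ω : Set (Euc n)} (hΩ : IsOpen Ω)
    (hb : Bornology.IsBounded Ω) (hS : HasSmoothBoundary Ω) (w : H1 Ω) :
    w ∈ (smoothH1 Ω).topologicalClosure := by
  choose! ρ hρ hker using fun x (hx : x ∈ closure Ω) => exists_isKernel hΩ hS hx
  obtain ⟨t, χ, htK, hχ, hχs, hsum⟩ := exists_finite_smooth_partition hb.isCompact_closure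
    (U := fun x => Metric.ball x (ρ x)) fun x hx =>
      ⟨Metric.isOpen_ball, Metric.mem_ball_self (hρ x hx)⟩
  have hχc : ∀ i, HasCompactSupport (χ i) := fun i =>
    (isCompact_closedBall (i : Euc n) (ρ i)).of_isClosed_subset (isClosed_tsupport _)
      ((hχs i).trans Metric.ball_subset_closedBall)
  choose L hL using fun i => exists_mul_cutoff hΩ (hχ i) (hχc i)
  have hw : w = ∑ i, L i w := by
    apply H1.ext_fn hΩ
    have hfn : (∑ i, L i w).fn = ∑ i, (L i w).fn := by
      exact map_sum (⟨⟨H1.fn, rfl⟩, fun _ _ => rfl⟩ : H1 Ω →+ _) _ _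
    rw [hfn]
    filter_upwards [Lp.coeFn_finsetSum Finset.univ fun i => (L i w).fn,
      eventually_countable_forall.2 fun i => (hL i w).1,
      ae_restrict_mem hΩ.measurableSet] with x h1 h2 h3
    rw [h1, Finset.sum_apply]
    simp_rw [h2]
    rw [← Finset.sum_mul, hsum x (subset_closure h3), one_mul]
  rw [hw]
  refine Submodule.sum_mem _ fun i _ => ?_
  have hg0 : ∀ y, y ∉ Metric.ball (i : Euc n) (ρ i) → χ i y = 0 ∧ gradient (χ i) y = 0 := by
    intro y hy
    have hy' : y ∉ tsupport (χ i) := fun h => hy (hχs i h)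
    refine ⟨image_eq_zero_of_notMem_tsupport hy', ?_⟩
    have : fderiv ℝ (χ i) y = 0 :=
      image_eq_zero_of_notMem_tsupport fun h => hy' (tsupport_fderiv_subset ℝ h)
    simp [gradient, this]
  exact mem_closure_smoothH1_of_kernel hΩ hb (hker i (htK i))
    ((hχ i).continuous.stronglyMeasurable.mul (Lp.stronglyMeasurable w.fn))
    (((hχ i).continuous.stronglyMeasurable.smul (Lp.stronglyMeasurable w.grad)).add
      ((Lp.stronglyMeasurable w.fn).smul (contDiff_gradient (hχ i)).continuous.stronglyMeasurable))
    ((memLp_congr_ae (hL i w).1).1 (Lp.memLp _)) ((memLp_congr_ae (hL i w).2).1 (Lp.memLp _))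
    ((L i w).isWeakGradient.congr (hL i w).1 (hL i w).2)
    (fun y hy => by simp [(hg0 y hy).1])
    (fun y hy => by simp [(hg0 y hy).1, (hg0 y hy).2])
    (hL i w).1 (hL i w).2

/-! ### The trace operator -/

/-- The trace inequality makes the projection of the complete trace graph to `H¹(Ω)` antilipschitz,
so its range is closed; the range contains the dense set of smooth functions. -/
theorem exists_hasTrace {m : ℕ} {Ω : Set (Euc (m + 1))} (hΩ : IsOpen Ω)
    (hb : Bornology.IsBounded Ω) (hS : HasSmoothBoundary Ω) (w : H1 Ω) :
    ∃ g : Lp ℝ 2 (surf (frontier Ω)), HasTrace w g := by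
  obtain ⟨C, hC, hle⟩ := exists_norm_trace_le hΩ hb hS
  have hcl : IsClosed (traceGraph Ω : Set (H1 Ω × Lp ℝ 2 (surf (frontier Ω)))) :=
    Submodule.isClosed_topologicalClosure _
  have hcomp : CompleteSpace (traceGraph Ω) := hcl.completeSpace_coe
  let f : traceGraph Ω → H1 Ω := fun q => q.1.1
  have hanti : AntilipschitzWith (Real.toNNReal (1 + C)) f := by
    refine AntilipschitzWith.of_le_mul_dist fun p q => ?_
    rw [Real.coe_toNNReal _ (by positivity)]
    have hpq : HasTrace (p.1.1 - q.1.1) (p.1.2 - q.1.2) := (traceGraph Ω).sub_mem p.2 q.2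
    have h1 := hle _ _ hpq
    rw [← dist_eq_norm, ← dist_eq_norm] at h1
    have hd : 0 ≤ dist p.1.1 q.1.1 := dist_nonneg
    change max (dist p.1.1 q.1.1) (dist p.1.2 q.1.2) ≤ (1 + C) * dist p.1.1 q.1.1
    apply max_le
    · nlinarith
    · nlinarith
  have hcont : UniformContinuous f := uniformContinuous_fst.comp uniformContinuous_subtype_val
  have hrange : IsClosed (range f) := hanti.isClosed_range hcont
  have hsub : (smoothH1 Ω : Set (H1 Ω)) ⊆ range f := by
    rintro v ⟨φ, hφ, hv⟩
    obtain ⟨w', g, -, hw1, -, hg⟩ := exists_mem_smoothTraceGraph hΩ hb hS hφ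
    have hmem : (v, g) ∈ smoothTraceGraph Ω := ⟨φ, hφ, hv, hg⟩
    exact ⟨⟨(v, g), Submodule.le_topologicalClosure _ hmem⟩, rfl⟩
  obtain ⟨q, hq⟩ := hrange.closure_subset_iff.2 hsub (closure_smoothH1 hΩ hb hS w)
  refine ⟨q.1.2, ?_⟩
  rw [← hq]
  exact q.2

lemma HasTrace.add {n : ℕ} {Ω : Set (Euc n)} {v w : H1 Ω} {g h : Lp ℝ 2 (surf (frontier Ω))}
    (hv : HasTrace v g) (hw : HasTrace w h) : HasTrace (v + w) (g + h) :=
  (traceGraph Ω).add_mem hv hw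

lemma HasTrace.sub {n : ℕ} {Ω : Set (Euc n)} {v w : H1 Ω} {g h : Lp ℝ 2 (surf (frontier Ω))}
    (hv : HasTrace v g) (hw : HasTrace w h) : HasTrace (v - w) (g - h) :=
  (traceGraph Ω).sub_mem hv hw

lemma HasTrace.smul {n : ℕ} {Ω : Set (Euc n)} {v : H1 Ω} {g : Lp ℝ 2 (surf (frontier Ω))}
    (c : ℝ) (hv : HasTrace v g) : HasTrace (c • v) (c • g) :=
  (traceGraph Ω).smul_mem c hv

theorem HasTrace.unique {m : ℕ} {Ω : Set (Euc (m + 1))} (hΩ : IsOpen Ω)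
    (hb : Bornology.IsBounded Ω) (hS : HasSmoothBoundary Ω) {w : H1 Ω}
    {g h : Lp ℝ 2 (surf (frontier Ω))} (hg : HasTrace w g) (hh : HasTrace w h) : g = h := by
  obtain ⟨C, hC, hle⟩ := exists_norm_trace_le hΩ hb hS
  have := hle _ _ (hg.sub hh)
  rw [sub_self, norm_zero, mul_zero] at this
  exact sub_eq_zero.1 (norm_le_zero_iff.1 this)

/-- The trace operator as a continuous linear map. -/
theorem exists_traceL {m : ℕ} {Ω : Set (Euc (m + 1))} (hΩ : IsOpen Ω)
    (hb : Bornology.IsBounded Ω) (hS : HasSmoothBoundary Ω) :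
    ∃ tr : H1 Ω →L[ℝ] Lp ℝ 2 (surf (frontier Ω)), ∀ w, HasTrace w (tr w) := by
  obtain ⟨C, hC, hle⟩ := exists_norm_trace_le hΩ hb hS
  choose tr htr using exists_hasTrace hΩ hb hS
  exact ⟨LinearMap.mkContinuous
    ⟨⟨tr, fun v w => (htr (v + w)).unique hΩ hb hS ((htr v).add (htr w))⟩,
      fun c w => (htr (c • w)).unique hΩ hb hS ((htr w).smul c)⟩ C fun w => hle _ _ (htr w), htr⟩


/-! ### Functions with vanishing product have traces with vanishing product -/

/-- The integrand is `∂_ν(θ v w)` with `θ` supported in `Ω`. For smooth `v` and `w` it integrates to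
zero, and both sides are continuous in the pair. -/
lemma integral_leibniz_eq_zero {n : ℕ} {Ω : Set (Euc n)} (hΩ : IsOpen Ω)
    (hb : Bornology.IsBounded Ω) (hS : HasSmoothBoundary Ω) {θ : Euc n → ℝ}
    (hθ : ContDiff ℝ ∞ θ) (hθc : HasCompactSupport θ) (hθs : tsupport θ ⊆ Ω) (ν : Euc n)
    (v w : H1 Ω) :
    ∫ x in Ω, (fderiv ℝ θ x ν * (v.fn x * w.fn x) +
      θ x * (inner ℝ (v.grad x) ν * w.fn x + v.fn x * inner ℝ (w.grad x) ν)) = 0 := by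
  obtain ⟨B, hBc, -, hB⟩ := exists_leibniz Ω hθ hθc ν
  rw [← integral_congr_ae (hB v w)]
  let S : Set (H1 Ω × H1 Ω) := {p | ∫ x in Ω, B p.1 p.2 x = 0}
  have hS' : IsClosed S := isClosed_eq (continuous_integral.comp hBc) continuous_const
  have hsub : (smoothH1 Ω : Set (H1 Ω)) ×ˢ (smoothH1 Ω : Set (H1 Ω)) ⊆ S := by
    rintro ⟨v, w⟩ ⟨⟨φ, hφ, h1⟩, ⟨ψ, hψ, h2⟩⟩
    have e1 := H1.grad_ae_eq hΩ hb hφ h1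
    have e2 := H1.grad_ae_eq hΩ hb hψ h2
    have hf : ContDiff ℝ ∞ fun x => θ x * (φ x * ψ x) := hθ.mul (hφ.mul hψ)
    -- The constant function `1` has zero gradient; testing this against `θ * (φ * ψ)` gives the
    -- vanishing integral.
    have h0 := isWeakGradient_of_contDiff Ω (f := fun _ => (1 : ℝ)) contDiff_const _ hf
      hθc.mul_right (tsupport_mul_subset_left.trans hθs) ν
    simp only [one_mul, inner_gradient, fderiv_fun_const, Pi.zero_apply,
      zero_apply, zero_mul, integral_zero, neg_zero] at h0
    change ∫ x in Ω, B v w x = 0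
    rw [← h0]
    apply integral_congr_ae
    filter_upwards [hB v w, h1, h2, e1, e2] with x k1 k2 k3 k4 k5
    rw [k1, fderiv_mul_mul hθ hφ hψ, ← inner_gradient φ, ← inner_gradient ψ]
    rw [k2, k3, k4, k5]
  have hmem : (v, w) ∈ closure ((smoothH1 Ω : Set (H1 Ω)) ×ˢ (smoothH1 Ω : Set (H1 Ω))) := by
    rw [closure_prod_eq]
    exact ⟨closure_smoothH1 hΩ hb hS v, closure_smoothH1 hΩ hb hS w⟩
  exact hS'.closure_subset_iff.2 hsub hmem

/-- For `θ` supported in `U` the term with `∂_ν θ` drops out because `v * w` vanishes there; what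
remains integrates to zero against every such `θ`. -/
lemma dirDeriv_mul_ae_eq_zero {n : ℕ} {Ω : Set (Euc n)} (hΩ : IsOpen Ω)
    (hb : Bornology.IsBounded Ω) (hS : HasSmoothBoundary Ω) {U : Set (Euc n)} (hU : IsOpen U)
    (hUΩ : U ⊆ Ω) (ν : Euc n) {v w : H1 Ω}
    (h : ∀ᵐ x ∂(volume : Measure (Euc n)).restrict Ω, x ∈ U → v.fn x * w.fn x = 0) :
    ∀ᵐ x ∂(volume : Measure (Euc n)).restrict Ω, x ∈ U →
      inner ℝ (v.grad x) ν * w.fn x + v.fn x * inner ℝ (w.grad x) ν = 0 := by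
  have hint : Integrable (fun x => inner ℝ (v.grad x) ν * w.fn x + v.fn x * inner ℝ (w.grad x) ν)
      (volume.restrict Ω) :=
    (MemLp.integrable_mul (p := 2) (q := 2) ((Lp.memLp v.grad).inner_const ν) (Lp.memLp w.fn)).add
      (MemLp.integrable_mul (p := 2) (q := 2) (Lp.memLp v.fn) ((Lp.memLp w.grad).inner_const ν))
  have := hU.ae_eq_zero_of_integral_contDiff_smul_eq_zero (μ := volume)
    ((IntegrableOn.locallyIntegrableOn hint).mono_set hUΩ) (by
      intro θ h1 h2 h3
      rw [← integral_leibniz_eq_zero hΩ hb hS h1 h2 (h3.trans hUΩ) ν v w,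
        ← setIntegral_eq_integral_of_forall_compl_eq_zero (s := Ω)]
      · apply integral_congr_ae
        filter_upwards [h] with x hx
        by_cases hxU : x ∈ U
        · rw [hx hxU, mul_zero, zero_add, smul_eq_mul]
        · have h4 : θ x = 0 := image_eq_zero_of_notMem_tsupport fun h' => hxU (h3 h')
          have h5 : fderiv ℝ θ x = 0 := image_eq_zero_of_notMem_tsupport fun h' =>
            hxU (h3 (tsupport_fderiv_subset ℝ h'))
          simp [h4, h5]
      · intro x hx
        rw [image_eq_zero_of_notMem_tsupport fun h' => hx (hUΩ (h3 h')), zero_smul])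
  exact ae_restrict_of_ae this

/-- With a bump `b` supported near `x`, the function `∂_ν(b v w)` is zero almost everywhere, so the
trace inequality forces `b γ(v) γ(w) = 0` on the boundary. -/
theorem trace_mul_trace_eq_zero {m : ℕ} {Ω : Set (Euc (m + 1))} (hΩ : IsOpen Ω)
    (hb : Bornology.IsBounded Ω) (hS : HasSmoothBoundary Ω) {v w : H1 Ω}
    {g h : Lp ℝ 2 (surf (frontier Ω))} (hv : HasTrace v g) (hw : HasTrace w h)
    {x : Euc (m + 1)} (hx : x ∈ frontier Ω) {N : Set (Euc (m + 1))} (hN : N ∈ 𝓝 x)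
    (hvw : ∀ᵐ y ∂(volume : Measure (Euc (m + 1))).restrict Ω, y ∈ N → v.fn y * w.fn y = 0) :
    ∃ N' ∈ 𝓝 x, ∀ᵐ y ∂surf (frontier Ω), y ∈ N' → g y * h y = 0 := by
  obtain ⟨ν, ρ, C, hρ, -, hineq⟩ := exists_trace_mul_inequality hΩ hb hS hx
  obtain ⟨ρ', hρ', hN'⟩ := Metric.mem_nhds_iff.1 hN
  have hm : 0 < min ρ ρ' := lt_min hρ hρ'
  let b : ContDiffBump x := ⟨min ρ ρ' / 3, min ρ ρ' / 2, by positivity, by linarith⟩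
  have hbs : tsupport b ⊆ Metric.ball x (min ρ ρ') := by
    rw [b.tsupport_eq]
    exact Metric.closedBall_subset_ball (by change min ρ ρ' / 2 < min ρ ρ'; linarith)
  obtain ⟨B, hBc, -, hB⟩ := exists_leibniz Ω b.contDiff b.hasCompactSupport ν
  have hU : IsOpen (Ω ∩ Metric.ball x ρ') := hΩ.inter Metric.isOpen_ball
  have hzero := dirDeriv_mul_ae_eq_zero hΩ hb hS hU inter_subset_left ν (v := v) (w := w)
    (hvw.mono fun y hy hyU => hy (hN' hyU.2))
  have hB0 : B v w = 0 := by
    apply Lp.ext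
    filter_upwards [hB v w, hvw, hzero, ae_restrict_mem hΩ.measurableSet,
      Lp.coeFn_zero ℝ 1 ((volume : Measure (Euc (m + 1))).restrict Ω)] with y h1 h2 h3 h4 h5
    rw [h1, h5]
    by_cases hy : y ∈ Metric.ball x ρ'
    · rw [h2 (hN' hy), h3 ⟨h4, hy⟩]
      simp
    · have hy' : y ∉ tsupport b := fun h' =>
        hy (Metric.ball_subset_ball (min_le_right _ _) (hbs h'))
      have k1 : b y = 0 := image_eq_zero_of_notMem_tsupport hy'
      have k2 : fderiv ℝ b y = 0 := image_eq_zero_of_notMem_tsupport fun h' =>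
        hy' (tsupport_fderiv_subset ℝ h')
      simp [k1, k2]
  have h0 := hineq b b.contDiff b.hasCompactSupport
    (hbs.trans (Metric.ball_subset_ball (min_le_left _ _))) B hBc hB v w g h hv hw
  rw [hB0, enorm_zero, mul_zero, nonpos_iff_eq_zero, lintegral_eq_zero_iff' (by
    exact (b.continuous.aestronglyMeasurable.mul ((Lp.aestronglyMeasurable g).mul
      (Lp.aestronglyMeasurable h))).enorm)] at h0
  refine ⟨Metric.ball x (min ρ ρ' / 3), Metric.ball_mem_nhds x (by positivity), ?_⟩
  filter_upwards [h0] with y hy hyb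
  have : b y = 1 := b.one_of_mem_closedBall (Metric.ball_subset_closedBall hyb)
  simpa [this] using hy

/-! ### Supports -/

/-- `V` is a union of open sets on each of which `w` vanishes almost everywhere; second countability
makes the exceptional set null. -/
lemma suppH1_eq {n : ℕ} {Ω : Set (Euc n)} (w : H1 Ω) :
    ∃ V : Set (Euc n), IsOpen V ∧ suppH1 w = Ω \ V ∧
      ∀ᵐ x ∂(volume : Measure (Euc n)).restrict Ω, x ∈ V → w.fn x = 0 := by
  let μ := (volume : Measure (Euc n)).restrict Ω
  let V : Set (Euc n) := {x | ∃ U ∈ 𝓝 x, w.fn =ᵐ[volume.restrict (Ω ∩ U)] 0}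
  refine ⟨V, ?_, ?_, ?_⟩
  · rw [isOpen_iff_mem_nhds]
    rintro x ⟨U, hU, h⟩
    filter_upwards [interior_mem_nhds.2 hU] with y hy
    exact ⟨U, mem_interior_iff_mem_nhds.1 hy, h⟩
  · ext x
    simp [suppH1, V]
  · have : μ {x | x ∈ V ∧ w.fn x ≠ 0} = 0 := by
      refine measure_null_of_locally_null _ ?_
      rintro x ⟨⟨U, hU, h⟩, -⟩
      refine ⟨interior U ∩ {x | w.fn x ≠ 0}, ?_, ?_⟩
      · rw [mem_nhdsWithin_iff_exists_mem_nhds_inter]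
        exact ⟨interior U, interior_mem_nhds.2 hU, fun y hy => ⟨hy.1, hy.2.2⟩⟩
      · have h' : w.fn =ᵐ[μ.restrict (interior U)] 0 := by
          rw [Measure.restrict_restrict isOpen_interior.measurableSet, inter_comm]
          exact ae_restrict_of_ae_restrict_of_subset
            (inter_subset_inter_right _ interior_subset) h
        have h2 := (ae_restrict_iff' isOpen_interior.measurableSet).1 h'
        rw [ae_iff] at h2
        convert h2 using 2
        ext y
        simp
    rw [ae_iff]
    convert this using 2
    ext y
    simp

lemma surf_mono {n : ℕ} {S S' : Set (Euc n)} (h : S ⊆ S') : surf S ≤ surf S' :=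
  Measure.restrict_mono h le_rfl

/-- A function of `H¹(Ω)` that vanishes on `Ω₂` near every point of `Γ` has zero trace on `Γ`. -/
theorem trace_eq_zero_on {m : ℕ} {Ω : Set (Euc (m + 1))} (hΩ : IsOpen Ω)
    (hb : Bornology.IsBounded Ω) (hS : HasSmoothBoundary Ω) {Γ : Set (Euc (m + 1))}
    (hΓ : IsBoundaryRegion Ω Γ) {T : Hhalf Ω →ₗ[ℝ] H1 Ω} (hT : IsTraceLifting T) {v : H1 Ω}
    {g : Lp ℝ 2 (surf (frontier Ω))} (hv : HasTrace v g)
    (h : ∀ x ∈ Γ, ∃ N ∈ 𝓝 x, v ∈ vanishingOn Ω (N ∩ liftedSupport T Γ)) :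
    g =ᵐ[surf Γ] 0 := by
  have key : ∀ x ∈ Γ, Γ ∈ 𝓝[frontier Ω] x →
      ∃ N' ∈ 𝓝 x, ∀ᵐ y ∂surf (frontier Ω), y ∈ N' → g y = 0 := by
    intro x hx hxΓ
    obtain ⟨U, hU, hUΓ⟩ := mem_nhdsWithin_iff_exists_mem_nhds_inter.1 hxΓ
    obtain ⟨N, hN, hvN⟩ := h x hx
    obtain ⟨ρ, hρ, hρU⟩ := Metric.mem_nhds_iff.1 hU
    let b : ContDiffBump x := ⟨ρ / 3, ρ / 2, by positivity, by linarith⟩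
    have hbs : tsupport b ⊆ U := by
      rw [b.tsupport_eq]
      exact (Metric.closedBall_subset_ball (by change ρ / 2 < ρ; linarith)).trans hρU
    -- The bump is supported in `U`, and `U ∩ frontier Ω ⊆ Γ`, so `h₀` is the zero extension of its
    -- restriction to `Γ`. Its lifting thus competes in the definition of `Ω₂`.
    obtain ⟨w₀, h₀, hw₀, -, -, hh₀⟩ := exists_mem_smoothTraceGraph hΩ hb hS
      (b.contDiff (n := ⊤))
    let q : Hhalf Ω := ⟨h₀, ⟨(w₀, h₀), Submodule.le_topologicalClosure _ hw₀, rfl⟩⟩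
    have hzm : MemLp h₀ 2 (surf Γ) := (Lp.memLp h₀).mono_measure (surf_mono hΓ.1)
    have hsupp : suppH1 (T q) ⊆ liftedSupport T Γ := by
      intro y hy
      refine ⟨hzm.toLp _, q, ⟨q, hzm.coeFn_toLp⟩, ⟨hzm.coeFn_toLp.symm, ?_⟩, hy⟩
      have e1 : h₀ =ᵐ[surf (frontier Ω \ Γ)] b :=
        (Measure.absolutelyContinuous_of_le (surf_mono sdiff_subset)).ae_le hh₀
      refine e1.trans ?_
      filter_upwards [ae_restrict_mem (isClosed_frontier.measurableSet.diff hΓ.2.1)] with y hy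
      exact image_eq_zero_of_notMem_tsupport fun h' => hy.2 (hUΓ ⟨hbs h', hy.1⟩)
    obtain ⟨V, hV, hVe, hV0⟩ := suppH1_eq (T q)
    have hvN' : v.fn =ᵐ[(volume : Measure (Euc (m + 1))).restrict (Ω ∩ (interior N \ V))] 0 := by
      refine ae_restrict_of_ae_restrict_of_subset ?_ hvN
      rintro y ⟨hy1, hy2, hy3⟩
      exact ⟨hy1, interior_subset hy2, hsupp (hVe ▸ ⟨hy1, hy3⟩)⟩
    rw [inter_comm, ← Measure.restrict_restrict (isOpen_interior.measurableSet.diff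
      hV.measurableSet), Filter.EventuallyEq, ae_restrict_iff' (isOpen_interior.measurableSet.diff
      hV.measurableSet)] at hvN'
    -- Near `x` the product of `v` and `T q` vanishes: on `V` because `T q` does, and off `V`
    -- because such points lie in `Ω₂`, where `v` does.
    obtain ⟨N', hN', hgh⟩ := trace_mul_trace_eq_zero hΩ hb hS hv (hT.2 q) (hΓ.1 hx)
      (interior_mem_nhds.2 hN) (by
        filter_upwards [hvN', hV0] with y h1 h2 hyN
        by_cases hyV : y ∈ V
        · rw [h2 hyV, mul_zero]
        · rw [h1 ⟨hyN, hyV⟩, Pi.zero_apply, zero_mul])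
    refine ⟨N' ∩ Metric.ball x (ρ / 3), inter_mem hN' (Metric.ball_mem_nhds x (by positivity)), ?_⟩
    filter_upwards [hgh, hh₀] with y h1 h2 hy
    have h3 := h1 hy.1
    have h4 : b y = 1 := b.one_of_mem_closedBall (Metric.ball_subset_closedBall hy.2)
    change g y * h₀ y = 0 at h3
    rw [h2, h4, mul_one] at h3
    exact h3
  -- The local null sets combine by second countability; the points of `Γ` not interior to it are
  -- null by `hΓ`.
  have hnull : surf (frontier Ω) {y | y ∈ Γ ∧ Γ ∈ 𝓝[frontier Ω] y ∧ g y ≠ 0} = 0 := by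
    refine measure_null_of_locally_null _ ?_
    rintro x ⟨hx, hxΓ, -⟩
    obtain ⟨N', hN', h0⟩ := key x hx hxΓ
    refine ⟨N' ∩ {y | g y ≠ 0}, ?_, ?_⟩
    · rw [mem_nhdsWithin_iff_exists_mem_nhds_inter]
      exact ⟨N', hN', fun y hy => ⟨hy.1, hy.2.2.2⟩⟩
    · rw [ae_iff] at h0
      convert h0 using 2
      ext y
      simp
  have hnull' := nonpos_iff_eq_zero.1 ((surf_mono hΓ.1 _).trans hnull.le)
  have hae : ∀ᵐ y ∂surf Γ, Γ ∈ 𝓝[frontier Ω] y := by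
    rw [ae_iff]
    exact hΓ.2.2
  filter_upwards [measure_eq_zero_iff_ae_notMem.1 hnull', hae,
    ae_restrict_mem hΓ.2.1] with y h1 h2 h3
  by_contra h4
  exact h1 ⟨h3, h2, h4⟩


/-! ### The lifted support is relatively closed -/

lemma HhalfNorm_nonneg {n : ℕ} {Ω : Set (Euc n)} (g : Hhalf Ω) : 0 ≤ HhalfNorm g := by
  apply Real.sInf_nonneg
  rintro c ⟨w, -, rfl⟩
  exact norm_nonneg _

lemma HhalfNorm_le {n : ℕ} {Ω : Set (Euc n)} {w : H1 Ω} {g : Hhalf Ω} (h : HasTrace w g) :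
    HhalfNorm g ≤ ‖w‖ := by
  apply csInf_le
  · refine ⟨0, ?_⟩
    rintro c ⟨w, -, rfl⟩
    exact norm_nonneg _
  · exact ⟨w, h, rfl⟩

lemma HasTrace.mem_Hhalf {n : ℕ} {Ω : Set (Euc n)} {w : H1 Ω} {g : Lp ℝ 2 (surf (frontier Ω))}
    (h : HasTrace w g) : g ∈ Hhalf Ω :=
  ⟨(w, g), h, rfl⟩

lemma HhalfNormOn_le {n : ℕ} {Ω Γ : Set (Euc n)} {w : H1 Ω} {g : Lp ℝ 2 (surf (frontier Ω))}
    {z : Lp ℝ 2 (surf Γ)} (h : HasTrace w g) (hz : IsRestriction Γ g z) :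
    HhalfNormOn Ω Γ z ≤ ‖w‖ := by
  refine le_trans (csInf_le ?_ ⟨⟨g, h.mem_Hhalf⟩, hz, rfl⟩) (HhalfNorm_le h)
  refine ⟨0, ?_⟩
  rintro c ⟨g, -, rfl⟩
  exact HhalfNorm_nonneg g

lemma isClosed_ae_restrict_eq_zero {α : Type*} {m : MeasurableSpace α} (μ : Measure α)
    (A : Set α) : IsClosed {f : Lp ℝ 2 μ | f =ᵐ[μ.restrict A] 0} := by
  have : {f : Lp ℝ 2 μ | f =ᵐ[μ.restrict A] 0} =
      {f | LpToLpRestrictCLM α ℝ ℝ μ 2 A f = 0} := by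
    ext f
    simp only [mem_ofPred_eq]
    rw [Lp.eq_zero_iff_ae_eq_zero]
    have h := LpToLpRestrictCLM_coeFn (p := 2) (μ := μ) ℝ A f
    exact ⟨fun h' => h.trans h', fun h' => h.symm.trans h'⟩
  rw [this]
  exact isClosed_eq (LpToLpRestrictCLM α ℝ ℝ μ 2 A).continuous continuous_const

lemma isClosed_vanishingOn {n : ℕ} (Ω : Set (Euc n)) {O : Set (Euc n)} (hO : MeasurableSet O) :
    IsClosed (vanishingOn Ω O : Set (H1 Ω)) := by
  have h := (isClosed_ae_restrict_eq_zero ((volume : Measure (Euc n)).restrict Ω) O).preimage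
    (H1.continuous_fn (U := Ω))
  rw [Measure.restrict_restrict hO, inter_comm] at h
  exact h

/-- Baire: a closed subspace covered by countably many closed subspaces is contained in one. -/
theorem exists_le_of_forall_mem {E : Type*} [NormedAddCommGroup E] [NormedSpace ℝ E]
    [CompleteSpace E] {V : Submodule ℝ E} (hV : IsClosed (V : Set E)) {F : ℕ → Submodule ℝ E}
    (hF : ∀ k, IsClosed (F k : Set E)) (h : ∀ w ∈ V, ∃ k, w ∈ F k) : ∃ k, V ≤ F k := by
  have : CompleteSpace V := hV.completeSpace_coe
  have hcl : ∀ k, IsClosed ((F k).comap V.subtype : Set V) := fun k =>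
    (hF k).preimage continuous_subtype_val
  obtain ⟨k, hk⟩ := nonempty_interior_of_iUnion_of_closed hcl
    (eq_univ_of_forall fun w => mem_iUnion.2 (h w.1 w.2))
  refine ⟨k, fun w hw => ?_⟩
  have htop := Submodule.eq_top_of_nonempty_interior' _ hk
  have : (⟨w, hw⟩ : V) ∈ (F k).comap V.subtype := htop ▸ Submodule.mem_top
  exact this

/-- A union of closed supports need not be closed. If `y` avoids all of them, each lifting vanishes
on a ball about `y` whose radius depends on the lifting. Baire's theorem, in the closed space `V` of
functions with trace zero off `Γ`, gives one radius for all, so that ball misses `Ω₂`. -/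
theorem isOpen_diff_liftedSupport {m : ℕ} {Ω : Set (Euc (m + 1))} (hΩ : IsOpen Ω)
    (hb : Bornology.IsBounded Ω) (hS : HasSmoothBoundary Ω) {Γ : Set (Euc (m + 1))}
    (hΓ : IsBoundaryRegion Ω Γ) {T : Hhalf Ω →ₗ[ℝ] H1 Ω} (hT : IsTraceLifting T) :
    IsOpen (Ω \ liftedSupport T Γ) := by
  obtain ⟨tr, htr⟩ := exists_traceL hΩ hb hS
  obtain ⟨C, hC⟩ := hT.1
  let tr' : H1 Ω →ₗ[ℝ] Hhalf Ω := tr.toLinearMap.codRestrict (Hhalf Ω) fun w => (htr w).mem_Hhalf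
  -- `T` is precomposed with the trace, so that the category argument runs in the complete space
  -- `H¹(Ω)`; `|C|` is used because `C` has no prescribed sign.
  let E : H1 Ω →L[ℝ] H1 Ω := LinearMap.mkContinuous (T.comp tr') |C| fun w => by
    refine (hC (tr' w)).trans ?_
    have h1 : HhalfNorm (tr' w) ≤ ‖w‖ := HhalfNorm_le (htr w)
    calc C * HhalfNorm (tr' w) ≤ |C| * HhalfNorm (tr' w) :=
          mul_le_mul_of_nonneg_right (le_abs_self C) (HhalfNorm_nonneg _)
      _ ≤ |C| * ‖w‖ := mul_le_mul_of_nonneg_left h1 (abs_nonneg C)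
  have hrestr : surf (frontier Ω \ Γ) = (surf (frontier Ω)).restrict Γᶜ := by
    rw [surf, surf, Measure.restrict_restrict hΓ.2.1.compl, inter_comm]
    rfl
  let Z : Submodule ℝ (Lp ℝ 2 (surf (frontier Ω))) :=
    { carrier := {f | f =ᵐ[(surf (frontier Ω)).restrict Γᶜ] 0}
      add_mem' := fun {f g} hf hg => by
        have h := ae_restrict_of_ae (s := Γᶜ) (Lp.coeFn_add f g)
        have hf : f =ᵐ[(surf (frontier Ω)).restrict Γᶜ] 0 := hf
        have hg : g =ᵐ[(surf (frontier Ω)).restrict Γᶜ] 0 := hg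
        change (f + g : Lp ℝ 2 _) =ᵐ[(surf (frontier Ω)).restrict Γᶜ] 0
        filter_upwards [h, hf, hg] with x h1 h2 h3
        rw [h1, Pi.add_apply, h2, h3, Pi.zero_apply, add_zero]
      zero_mem' := ae_restrict_of_ae (Lp.coeFn_zero ℝ 2 _)
      smul_mem' := fun c f hf => by
        have h := ae_restrict_of_ae (s := Γᶜ) (Lp.coeFn_smul c f)
        have hf : f =ᵐ[(surf (frontier Ω)).restrict Γᶜ] 0 := hf
        change (c • f : Lp ℝ 2 _) =ᵐ[(surf (frontier Ω)).restrict Γᶜ] 0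
        filter_upwards [h, hf] with x h1 h2
        rw [h1, Pi.smul_apply, h2, Pi.zero_apply, smul_zero] }
  let V : Submodule ℝ (H1 Ω) := Z.comap tr.toLinearMap
  have hVcl : IsClosed (V : Set (H1 Ω)) :=
    (isClosed_ae_restrict_eq_zero (surf (frontier Ω)) Γᶜ).preimage tr.continuous
  rw [isOpen_iff_mem_nhds]
  rintro y ⟨hyΩ, hy⟩
  let F : ℕ → Submodule ℝ (H1 Ω) := fun k =>
    (vanishingOn Ω (Metric.ball y (1 / ((k : ℝ) + 1)))).comap E.toLinearMap
  have hFcl : ∀ k, IsClosed (F k : Set (H1 Ω)) := fun k =>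
    (isClosed_vanishingOn Ω measurableSet_ball).preimage E.continuous
  have hcover : ∀ w ∈ V, ∃ k, w ∈ F k := by
    intro w hw
    have hw0 : tr w =ᵐ[surf (frontier Ω \ Γ)] 0 := by
      rw [hrestr]
      exact hw
    have hzm : MemLp (tr w) 2 (surf Γ) := (Lp.memLp (tr w)).mono_measure (surf_mono hΓ.1)
    have hy' : y ∉ suppH1 (T (tr' w)) := fun h' =>
      hy ⟨hzm.toLp _, tr' w, ⟨tr' w, hzm.coeFn_toLp⟩, ⟨hzm.coeFn_toLp.symm, hw0⟩, h'⟩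
    simp only [suppH1, mem_ofPred_eq, not_and, not_forall, not_not] at hy'
    obtain ⟨U, hU, hU0⟩ := hy' hyΩ
    obtain ⟨ρ, hρ, hρU⟩ := Metric.mem_nhds_iff.1 hU
    obtain ⟨k, hk⟩ := exists_nat_one_div_lt hρ
    exact ⟨k, ae_restrict_of_ae_restrict_of_subset (inter_subset_inter_right _
      ((Metric.ball_subset_ball hk.le).trans hρU)) hU0⟩
  obtain ⟨k, hk⟩ := exists_le_of_forall_mem hVcl hFcl hcover
  filter_upwards [hΩ.mem_nhds hyΩ, Metric.ball_mem_nhds y (Nat.one_div_pos_of_nat (n := k))]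
    with x hxΩ hx
  refine ⟨hxΩ, ?_⟩
  rintro ⟨z, ⟨g, ⟨⟨w, g'⟩, hwg, rfl⟩⟩, -, hz, hxs⟩
  have hg : tr w = g' := (htr w).unique hΩ hb hS hwg
  have hwV : w ∈ V := by
    change tr w =ᵐ[(surf (frontier Ω)).restrict Γᶜ] 0
    rw [hg, ← hrestr]
    exact hz.2
  have h0 : (T (tr' w)).fn =ᵐ[volume.restrict (Ω ∩ Metric.ball y (1 / ((k : ℝ) + 1)))] 0 := hk hwV
  have he : tr' w = ⟨g', ⟨(w, g'), hwg, rfl⟩⟩ := Subtype.ext hg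
  rw [he] at h0
  exact hxs.2 _ (Metric.isOpen_ball.mem_nhds hx) h0

/-! ### Cutoff functions -/

lemma exists_smooth_cutoff {n : ℕ} {K D : Set (Euc n)} (hK : IsCompact K) (hD : IsOpen D)
    (hKD : K ⊆ D) : ∃ χ : Euc n → ℝ, ContDiff ℝ ∞ χ ∧ HasCompactSupport χ ∧ tsupport χ ⊆ D ∧
      ∀ x ∈ K, ∀ᶠ y in 𝓝 x, χ y = 1 := by
  obtain ⟨R, hR⟩ := hK.isBounded.subset_ball 0
  have hs : IsClosed (D ∩ Metric.ball 0 R)ᶜ := (hD.inter Metric.isOpen_ball).isClosed_compl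
  obtain ⟨f, hf0, hf1, -⟩ := exists_contMDiffMap_zero_one_nhds_of_isClosed
    (modelWithCornersSelf ℝ (Euc n)) (n := ⊤) hs hK.isClosed
    (disjoint_left.2 fun x hx hxK => hx ⟨hKD hxK, hR hxK⟩)
  have ht : tsupport f ⊆ D ∩ Metric.ball 0 R := by
    intro x hx
    by_contra h
    exact notMem_tsupport_iff_eventuallyEq.2 (eventually_nhdsSet_iff_forall.1 hf0 x h) hx
  refine ⟨f, f.contMDiff.contDiff, ?_, ht.trans inter_subset_left,
    eventually_nhdsSet_iff_forall.1 hf1⟩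
  exact (isCompact_closedBall (0 : Euc n) R).of_isClosed_subset (isClosed_tsupport _)
    ((ht.trans inter_subset_right).trans Metric.ball_subset_closedBall)

/-! ### From the interior to the boundary -/

/-- If `z`, up to the error `e`, agrees with `w` on `Ω₂` near `Γ`, then the traces of `z` and `w`
on `Γ` agree up to the trace of `e`. -/
theorem exists_hasTraceOn_of_vanishing {m : ℕ} {Ω : Set (Euc (m + 1))} (hΩ : IsOpen Ω)
    (hb : Bornology.IsBounded Ω) (hS : HasSmoothBoundary Ω) {Γ : Set (Euc (m + 1))}
    (hΓ : IsBoundaryRegion Ω Γ) {T : Hhalf Ω →ₗ[ℝ] H1 Ω} (hT : IsTraceLifting T)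
    {z w e : H1 Ω} {g : Lp ℝ 2 (surf (frontier Ω))} (hw : HasTrace w g) {zb : Lp ℝ 2 (surf Γ)}
    (hzb : IsRestriction Γ g zb)
    (h : ∀ x ∈ Γ, ∃ N ∈ 𝓝 x, z - w - e ∈ vanishingOn Ω (N ∩ liftedSupport T Γ)) :
    (e = 0 → HasTraceOn Γ z zb) ∧
      ∃ y : Lp ℝ 2 (surf Γ), HasTraceOn Γ z y ∧ HhalfNormOn Ω Γ (y - zb) ≤ ‖e‖ := by
  have hac := (Measure.absolutelyContinuous_of_le (surf_mono hΓ.1)).ae_le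
  obtain ⟨tr, htr⟩ := exists_traceL hΩ hb hS
  have h0 := trace_eq_zero_on hΩ hb hS hΓ hT (((htr z).sub hw).sub (htr e)) h
  have h1 : ∀ᵐ x ∂surf Γ, tr z x - g x = tr e x := by
    filter_upwards [h0, hac (Lp.coeFn_sub (tr z - g) (tr e)), hac (Lp.coeFn_sub (tr z) g)]
      with x k1 k2 k3
    rw [k1, Pi.sub_apply, k3, Pi.sub_apply, Pi.zero_apply] at k2
    linarith
  constructor
  · rintro rfl
    refine ⟨tr z, htr z, ?_⟩
    rw [map_zero] at h1
    filter_upwards [h1, hzb, hac (Lp.coeFn_zero ℝ 2 (surf (frontier Ω)))] with x k1 k2 k3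
    rw [k3, Pi.zero_apply] at k1
    rw [k2]
    linarith
  · have hzm : MemLp (tr z) 2 (surf Γ) := (Lp.memLp (tr z)).mono_measure (surf_mono hΓ.1)
    refine ⟨hzm.toLp _, ⟨tr z, htr z, hzm.coeFn_toLp⟩, HhalfNormOn_le (htr e) ?_⟩
    filter_upwards [h1, hzb, hzm.coeFn_toLp, Lp.coeFn_sub (hzm.toLp _) zb] with x k1 k2 k3 k4
    rw [k4, Pi.sub_apply, k3, k2, k1]

lemma restr_eq_iff {n : ℕ} {Ω O : Set (Euc n)} {v w : H1 Ω} :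
    restr O v = restr O w ↔ v - w ∈ vanishingOn Ω O :=
  Submodule.Quotient.eq _

lemma vanishingOn_mono {n : ℕ} {Ω O O' : Set (Euc n)} (h : O ⊆ O') :
    vanishingOn Ω O' ≤ vanishingOn Ω O := fun _ hw =>
  ae_restrict_of_ae_restrict_of_subset (inter_subset_inter_right _ h) hw

lemma exists_mem_nhds_inter_subset_omegaR {n : ℕ} {Ω Γ : Set (Euc n)} (T : Hhalf Ω →ₗ[ℝ] H1 Ω)
    {r : ℝ} (hr : 0 < r) {x : Euc n} (hx : x ∈ Γ) :
    Metric.ball x r ∈ 𝓝 x ∧ Metric.ball x r ∩ liftedSupport T Γ ⊆ omegaR T Γ r :=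
  ⟨Metric.ball_mem_nhds x hr, inter_subset_inter_left _ (subset_biUnion_of_mem
    (u := fun x => Metric.ball x r) hx)⟩

lemma omegaR_subset {n : ℕ} {Ω Γ : Set (Euc n)} (T : Hhalf Ω →ₗ[ℝ] H1 Ω) (r : ℝ) :
    omegaR T Γ r ⊆ Ω := by
  rintro x ⟨-, z, g, -, -, hx⟩
  exact hx.1

/-- If `ω_r` is open, functions of `H¹(ω_r)` extend boundedly to functions of `H¹(Ω)` which agree
with them on `ω_r` near `Γ`. -/
theorem exists_extension_omegaR {m : ℕ} {Ω : Set (Euc (m + 1))} (hΩ : IsOpen Ω)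
    (hb : Bornology.IsBounded Ω) (hS : HasSmoothBoundary Ω) {Γ : Set (Euc (m + 1))}
    (hΓ : IsBoundaryRegion Ω Γ) {T : Hhalf Ω →ₗ[ℝ] H1 Ω} (hT : IsTraceLifting T) {r : ℝ}
    (hr : 0 < r) (hO : IsOpen (omegaR T Γ r)) :
    ∃ L : H1 (omegaR T Γ r) →L[ℝ] H1 Ω, ∀ x ∈ Γ, ∃ N ∈ 𝓝 x, N ∩ liftedSupport T Γ ⊆ omegaR T Γ r ∧
      IsOpen N ∧ ∀ y, ∀ᵐ a ∂(volume : Measure (Euc (m + 1))).restrict Ω,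
        a ∈ N → a ∈ omegaR T Γ r → (L y).fn a = y.fn a := by
  set D := ⋃ x ∈ Γ, Metric.ball x r with hDdef
  have hD : IsOpen D := isOpen_biUnion fun _ _ => Metric.isOpen_ball
  have hΓD : closure Γ ⊆ D := by
    rw [hDdef, ← Metric.thickening_eq_biUnion_ball]
    exact Metric.closure_subset_thickening hr Γ
  have hΓc : IsCompact (closure Γ) := by
    refine hb.isCompact_closure.of_isClosed_subset isClosed_closure ?_
    exact closure_minimal (hΓ.1.trans frontier_subset_closure) isClosed_closure
  obtain ⟨χ, hχ, hχc, hχD, hχ1⟩ := exists_smooth_cutoff hΓc hD hΓD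
  have hop := isOpen_diff_liftedSupport hΩ hb hS hΓ hT
  -- Inside `Ω ∩ D` the set `ω_r` coincides with `Ω₂`, whose complement in `Ω` is open, so its
  -- closure adds no points where `χ` lives.
  have hcl : tsupport χ ∩ Ω ∩ closure (omegaR T Γ r) ⊆ omegaR T Γ r := by
    rintro x ⟨⟨hx1, hx2⟩, hx3⟩
    refine ⟨hχD hx1, ?_⟩
    by_contra hx4
    obtain ⟨y, hy1, hy2⟩ := mem_closure_iff.1 hx3 _ hop ⟨hx2, hx4⟩
    exact hy1.2 hy2.2
  obtain ⟨L, hL⟩ := exists_cutoff hO (omegaR_subset T r) hχ hχc hcl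
  refine ⟨L, fun x hx => ?_⟩
  obtain ⟨N, hN, hNo, hxN⟩ := eventually_nhds_iff.1 (hχ1 x (subset_closure hx))
  obtain ⟨h1, h2⟩ := exists_mem_nhds_inter_subset_omegaR T hr hx
  refine ⟨N ∩ Metric.ball x r, inter_mem (hNo.mem_nhds hxN) h1, ?_, hNo.inter Metric.isOpen_ball,
    fun y => ?_⟩
  · exact (inter_subset_inter_left _ inter_subset_right).trans h2
  · filter_upwards [(hL y).1] with a ha haN haO
    rw [ha, indicator_of_mem haO, hN a haN.1, one_mul]

end FracCtrl

/-! ### From controllability on `ω_r` to boundary controllability -/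

theorem theorem5p1 {n p : ℕ} (hn : 1 ≤ n) (Ω : Set (FracCtrl.Euc n)) (hΩ_open : IsOpen Ω)
    (hΩ_bdd : Bornology.IsBounded Ω) (hΩ_smooth : FracCtrl.HasSmoothBoundary Ω)
    (Γ : Set (FracCtrl.Euc n)) (hΓ : FracCtrl.IsBoundaryRegion Ω Γ)
    (T : FracCtrl.Hhalf Ω →ₗ[ℝ] FracCtrl.H1 Ω) (hT : FracCtrl.IsTraceLifting T)
    (S : FracCtrl.FracSystem Ω p) (r : ℝ) (hr : 0 < r) :
    (S.ExactlyControllableOn (FracCtrl.omegaR T Γ r) → S.ExactlyBoundaryControllableOn Γ) ∧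
    (S.ApproxControllableOn (FracCtrl.omegaR T Γ r) → S.ApproxBoundaryControllableOn Γ) ∧
    (IsOpen (FracCtrl.omegaR T Γ r) →
      (S.ExactlyControllableOnOpen (FracCtrl.omegaR T Γ r) →
        S.ExactlyBoundaryControllableOn Γ) ∧
      (S.ApproxControllableOnOpen (FracCtrl.omegaR T Γ r) →
        S.ApproxBoundaryControllableOn Γ)) := by
  -- The boundary dimension `n - 1` becomes the natural number `m`, as the graph charts require.
  obtain ⟨m, rfl⟩ : ∃ m, n = m + 1 := ⟨n - 1, by omega⟩
  have local_vanishing : ∀ v : FracCtrl.H1 Ω, v ∈ FracCtrl.vanishingOn Ω (FracCtrl.omegaR T Γ r) →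
      ∀ x ∈ Γ, ∃ N ∈ 𝓝 x, v ∈ FracCtrl.vanishingOn Ω (N ∩ FracCtrl.liftedSupport T Γ) :=
    fun v hv x hx => ⟨_, (FracCtrl.exists_mem_nhds_inter_subset_omegaR T hr hx).1,
      FracCtrl.vanishingOn_mono (FracCtrl.exists_mem_nhds_inter_subset_omegaR T hr hx).2 hv⟩
  have exact_of : ∀ (z w : FracCtrl.H1 Ω) (g : Lp ℝ 2 (FracCtrl.surf (frontier Ω)))
      (zb : Lp ℝ 2 (FracCtrl.surf Γ)), FracCtrl.HasTrace w g → FracCtrl.IsRestriction Γ g zb →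
      z - w ∈ FracCtrl.vanishingOn Ω (FracCtrl.omegaR T Γ r) → FracCtrl.HasTraceOn Γ z zb := by
    intro z w g zb hw hzb h
    refine (FracCtrl.exists_hasTraceOn_of_vanishing hΩ_open hΩ_bdd hΩ_smooth hΓ hT (z := z)
      (e := 0) hw hzb ?_).1 rfl
    rw [sub_zero]
    exact local_vanishing _ h
  refine ⟨fun hS zb hzb => ?_, fun hS zb hzb ε hε => ?_, fun hO => ⟨fun hS zb hzb => ?_,
    fun hS zb hzb ε hε => ?_⟩⟩
  · obtain ⟨⟨g, ⟨w, g'⟩, hwg, rfl⟩, hzb⟩ := hzb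
    obtain ⟨u, z, hz, hrz⟩ := hS (FracCtrl.restr _ w)
    exact ⟨u, z, hz, exact_of z w g' zb hwg hzb (FracCtrl.restr_eq_iff.1 hrz)⟩
  · obtain ⟨⟨g, ⟨w, g'⟩, hwg, rfl⟩, hzb⟩ := hzb
    obtain ⟨u, z, hz, hrz⟩ := hS (FracCtrl.restr _ w) (ε / 2) (by positivity)
    -- A representative of the class of `z - w` whose norm exceeds the quotient norm by less than `ε
    -- / 2`.
    obtain ⟨e, he, hen⟩ := Submodule.Quotient.norm_mk_lt
      (FracCtrl.restr (FracCtrl.omegaR T Γ r) (z - w)) (half_pos hε)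
    have hrz' : ‖FracCtrl.restr (FracCtrl.omegaR T Γ r) (z - w)‖ ≤ ε / 2 := hrz
    obtain ⟨y, hy, hyn⟩ := (FracCtrl.exists_hasTraceOn_of_vanishing hΩ_open hΩ_bdd hΩ_smooth hΓ hT
      (z := z) (e := e) hwg hzb (local_vanishing _ (FracCtrl.restr_eq_iff.1 he.symm))).2
    exact ⟨u, z, hz, y, hy, by linarith⟩
  · obtain ⟨⟨g, ⟨w, g'⟩, hwg, rfl⟩, hzb⟩ := hzb
    obtain ⟨y, hy⟩ := FracCtrl.exists_isSobolevRestr (FracCtrl.omegaR_subset T r) w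
    obtain ⟨u, z, hz, hzy⟩ := hS y
    refine ⟨u, z, hz, exact_of z w g' zb hwg hzb ?_⟩
    change (z - w).fn =ᵐ[volume.restrict (Ω ∩ FracCtrl.omegaR T Γ r)] 0
    rw [inter_eq_self_of_subset_right (FracCtrl.omegaR_subset T r)]
    filter_upwards [hy, hzy, ae_restrict_of_ae_restrict_of_subset (FracCtrl.omegaR_subset T r)
      (FracCtrl.H1.coeFn_fn_sub z w)] with a h1 h2 h3
    rw [h3, Pi.sub_apply, ← h1, ← h2, sub_self, Pi.zero_apply]
  · obtain ⟨⟨g, ⟨w, g'⟩, hwg, rfl⟩, hzb⟩ := hzb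
    obtain ⟨L, hL⟩ := FracCtrl.exists_extension_omegaR hΩ_open hΩ_bdd hΩ_smooth hΓ hT hr hO
    obtain ⟨y, hy⟩ := FracCtrl.exists_isSobolevRestr (FracCtrl.omegaR_subset T r) w
    -- The tolerance anticipates the loss `‖L‖` of the extension operator; adding `1` keeps the
    -- denominator positive.
    obtain ⟨u, z, hz, y', hzy', hyy'⟩ := hS y (ε / (‖L‖ + 1)) (by positivity)
    -- On `ω_r` near `Γ` the extension `L (y' - y)` equals `y' - y`, which is `z - w` there, so it
    -- can serve as the error `e`.
    obtain ⟨q, hq, hqn⟩ := (FracCtrl.exists_hasTraceOn_of_vanishing hΩ_open hΩ_bdd hΩ_smooth hΓ hT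
      (z := z) (e := L (y' - y)) hwg hzb (by
        intro x hx
        obtain ⟨N, hN, hNO, hNopen, hLN⟩ := hL x hx
        refine ⟨N, hN, ?_⟩
        have hsub : Ω ∩ (N ∩ FracCtrl.liftedSupport T Γ) ⊆ N ∩ FracCtrl.omegaR T Γ r :=
          fun a ha => ⟨ha.2.1, hNO ha.2⟩
        have hNm : MeasurableSet (N ∩ FracCtrl.omegaR T Γ r) := (hNopen.inter hO).measurableSet
        refine ae_restrict_of_ae_restrict_of_subset hsub ?_
        have hNΩ : N ∩ FracCtrl.omegaR T Γ r ⊆ Ω :=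
          inter_subset_right.trans (FracCtrl.omegaR_subset T r)
        filter_upwards [ae_restrict_mem hNm,
          ae_restrict_of_ae_restrict_of_subset inter_subset_right hy,
          ae_restrict_of_ae_restrict_of_subset inter_subset_right hzy',
          ae_restrict_of_ae_restrict_of_subset inter_subset_right
            (FracCtrl.H1.coeFn_fn_sub y' y),
          ae_restrict_of_ae_restrict_of_subset hNΩ (FracCtrl.H1.coeFn_fn_sub (z - w) (L (y' - y))),
          ae_restrict_of_ae_restrict_of_subset hNΩ (FracCtrl.H1.coeFn_fn_sub z w),
          ae_restrict_of_ae_restrict_of_subset hNΩ (hLN (y' - y))] with a h1 h2 h3 h4 h5 h6 h7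
        rw [h5, Pi.sub_apply, h6, Pi.sub_apply, h7 h1.1 h1.2, h4, Pi.sub_apply, h2, h3, sub_self,
          Pi.zero_apply])).2
    refine ⟨u, z, hz, q, hq, hqn.trans ?_⟩
    calc ‖L (y' - y)‖ ≤ ‖L‖ * ‖y' - y‖ := L.le_opNorm _
      _ ≤ (‖L‖ + 1) * (ε / (‖L‖ + 1)) := by
          gcongr
          linarith
      _ = ε := by field_simp
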